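/- Let $R$ be a commutative ring whose nilradical $\mathcal N R$ is a nilpotent ideal and whose spectrum is connected. Give $R((u))((t))$ the topology in which the sets $t^mR((u))[[t]]+\sum_{i\in\mathbf Z}u^{m_i}t^iR[[u]]$ ($m, m_i\in\mathbf Z$) form a base of neighbourhoods of $0$, and order $\mathbf Z^2$ lexicographically. Every $f\in R((u))((t))^*$ has a unique decomposition $$f=f_0\,u^{\nu_2(f)}t^{\nu_1(f)}\prod_{(i,j)<(0,0)}(1-a_{i,j}u^jt^i)\prod_{(i,j)>(0,0)}(1-a_{i,j}u^jt^i)$$ with $f_0\in R^*$, $\nu_1(f),\nu_2(f)\in\mathbf Z$, $a_{i,j}\in R$, where for $(i,j)<(0,0)$ the $a_{i,j}$ are nilpotent and vanish unless $i>n$ and $j>m$ for some integers $n,m$ depending on $f$, and where both products converge. Put $\nu(f,g)=\nu_2(f)\nu_1(g)-\nu_2(g)\nu_1(f)$ and $$A(f,g,h)=\nu(f,g)\nu(f,h)+\nu(g,h)\nu(g,f)+\nu(h,f)\nu(h,g)+\nu(f,g)\nu(f,h)\nu(g,h).$$ Let $b_{k,l}$ and $c_{m,n}$ be the coefficients of the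 corresponding decompositions of $g$ and $h$. The two-dimensional Contou-Carrère symbol of $f,g,h\in R((u))((t))^*$ is the element $$(f,g,h)=(-1)^{A(f,g,h)}f_0^{\nu(g,h)}g_0^{\nu(h,f)}h_0^{\nu(f,g)}\prod T(a_{i,j},b_{k,l},c_{m,n})\prod S(a_{i,j},b_{k,l})^{\nu_1(h)}\prod Q(a_{i,j},b_{k,l})^{\nu_2(h)}$$ $$\times\prod S(c_{m,n},a_{i,j})^{\nu_1(g)}\prod Q(c_{m,n},a_{i,j})^{\nu_2(g)}\prod S(b_{k,l},c_{m,n})^{\nu_1(f)}\prod Q(b_{k,l},c_{m,n})^{\nu_2(f)}$$ of $R^*$, where the products run over all indices in $\mathbf Z^2\setminus\{(0,0)\}$ and have only finitely many factors $\ne1$. Here, with $p_0=lm-nk$, $q_0=ni-jm$, $r_0=jk-li$ and $d=\gcd(p_0,q_0,r_0)$ taken with the common sign of $p_0,q_0,r_0$, $$T(a_{i,j},b_{k,l},c_{m,n})=\bigl(1-a_{i,j}^{p_0/d}\,b_{k,l}^{q_0/d}\,c_{m,n}^{r_0/d}\bigr)^{d}$$ if $p_0,q_0,r_0$ are all positive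 or all negative, and $T=1$ otherwise. If $jk-li=0$, $jl+ik<0$ and $jl\neq0$, then, with $e=\gcd(j,l)>0$, $$S(a_{i,j},b_{k,l})=\bigl(1-a_{i,j}^{|l|/e}\,b_{k,l}^{|j|/e}\bigr)^{-\operatorname{sgn}(l)\,e};$$ otherwise $S=1$. If $jk-li=0$, $jl+ik<0$ and $ik\neq0$, then, with $e=\gcd(i,k)>0$, $$Q(a_{i,j},b_{k,l})=\bigl(1-a_{i,j}^{|k|/e}\,b_{k,l}^{|i|/e}\bigr)^{\operatorname{sgn}(k)\,e};$$ otherwise $Q=1$. Let $k$ be a field. (1) For $R=k$ the two-dimensional Contou-Carrère symbol is well defined and coincides with the two-dimensional tame symbol: for all $f,g,h\in k((u))((t))^*$, $$(f,g,h)=(-1)^{A(f,g,h)}\,f^{\nu(g,h)}g^{\nu(h,f)}h^{\nu(f,g)}\bmod t\bmod u,$$ where on the right-hand side $\nu_1(x)$ is the order of $x$ in $t$, $\nu_2(x)$ is the order in $u$ of the leading coefficient of $x$, and $\nu$ and $A$ are formed from these. (2) For $R=k[\epsilon]/\epsilon^4$ and all $f,g,h\in k((u))((t))$ the two-dimensional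 Contou-Carrère symbol of $1+\epsilon f$, $1+\epsilon g$, $1+\epsilon h$ is well defined and $$(1+\epsilon f,\,1+\epsilon g,\,1+\epsilon h)=1+\epsilon^3\operatorname{Res}(f\,dg\wedge dh),$$ where $dg\wedge dh=\left(\frac{\partial g}{\partial u}\frac{\partial h}{\partial t}-\frac{\partial h}{\partial u}\frac{\partial g}{\partial t}\right)du\wedge dt$ and $\operatorname{Res}\bigl(\sum a_{i,j}u^jt^i\,du\wedge dt\bigr)=a_{-1,-1}$. -/

import Mathlib

namespace ContouCarrere

open Function

/-- The ring `R((u))((t))`: Laurent series in `t` whose coefficients are Laurent series in `u`.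
The coefficient of `u ^ j * t ^ i` in `x` is `(x.coeff i).coeff j`. -/
abbrev DoubleLaurent (R : Type*) [CommRing R] : Type _ := LaurentSeries (LaurentSeries R)

section Symbol

variable {R : Type*} [CommRing R]

/-- The monomial `r * u ^ j * t ^ i`. -/
noncomputable def mono (i j : ℤ) (r : R) : DoubleLaurent R :=
  HahnSeries.single i (HahnSeries.single j r)

/-- Membership in the basic open neighbourhood of zero
`t ^ m * R((u))[[t]] + ∑ i, u ^ (n i) * t ^ i * R[[u]]` of the natural topology of `R((u))((t))`. -/
def InNbhd (m : ℤ) (n : ℤ → ℤ) (x : DoubleLaurent R) : Prop :=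
  ∀ i < m, ∀ j < n i, (x.coeff i).coeff j = 0

/-- The infinite product of the factors `1 - a (i, j) * u ^ j * t ^ i`, `(i, j) ∈ s`, converges
(unconditionally) to `x` in the natural topology of `R((u))((t))`. -/
def HasInfiniteProduct (s : Set (ℤ × ℤ)) (a : ℤ × ℤ → R) (x : DoubleLaurent R) : Prop :=
  ∀ (m : ℤ) (n : ℤ → ℤ), ∃ S : Finset (ℤ × ℤ), (S : Set (ℤ × ℤ)) ⊆ s ∧
    ∀ S' : Finset (ℤ × ℤ), S ⊆ S' → (S' : Set (ℤ × ℤ)) ⊆ s →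
      InNbhd m n (∏ p ∈ S', (1 - mono p.1 p.2 (a p)) - x)

/-- The pairs `(i, j)` below `(0, 0)` in the lexicographical order. -/
def negIdx : Set (ℤ × ℤ) := {p | p.1 < 0 ∨ (p.1 = 0 ∧ p.2 < 0)}

/-- The pairs `(i, j)` above `(0, 0)` in the lexicographical order. -/
def posIdx : Set (ℤ × ℤ) := {p | 0 < p.1 ∨ (p.1 = 0 ∧ 0 < p.2)}

/-- The canonical decomposition of an element of `R((u))((t))ˣ`, where `R` has a nilpotent
nilradical and a connected spectrum (so that the two valuations are integers):
`f = f₋₁ * f₀ * u ^ ν₂ * t ^ ν₁ * f₁` with `f₀ ∈ Rˣ`,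
`f₋₁ = ∏ (1 - a (i, j) * u ^ j * t ^ i)` over `(i, j) < (0, 0)` with nilpotent `a (i, j)` that
vanish unless `i` and `j` are bounded from below, and
`f₁ = ∏ (1 - a (i, j) * u ^ j * t ^ i)` over `(i, j) > (0, 0)`. -/
structure Decomposition (f : DoubleLaurent R) where
  ν₁ : ℤ
  ν₂ : ℤ
  unit : Rˣ
  a : ℤ × ℤ → R
  neg : DoubleLaurent R
  pos : DoubleLaurent R
  a_zero : a (0, 0) = 0
  a_nilpotent : ∀ p ∈ negIdx, IsNilpotent (a p)
  a_bounded : ∃ i₀ j₀ : ℤ, ∀ p ∈ negIdx, a p ≠ 0 → i₀ < p.1 ∧ j₀ < p.2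
  neg_eq : HasInfiniteProduct negIdx a neg
  pos_eq : HasInfiniteProduct posIdx a pos
  eq_mul : f = neg * mono ν₁ ν₂ (unit : R) * pos

/-- For `p = (i, j)` and `q = (k, l)` the determinant with rows `(j, l)` and `(i, k)`. -/
def det (p q : ℤ × ℤ) : ℤ := p.2 * q.1 - q.2 * p.1

/-- The exponent of the sign in the symbol of three elements whose pairs of valuations
`(ν₁, ν₂)` are `p`, `q`, `r`. -/
def signExp (p q r : ℤ × ℤ) : ℤ :=
  det p q * det p r + det q r * det q p + det r p * det r q + det p q * det p r * det q r

open Classical in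
/-- An invertible element of `R` as an element of `Rˣ`. It is only used for elements `1 - x` with
`x` nilpotent; the value `1` at non-invertible elements is irrelevant. -/
noncomputable def toUnit (x : R) : Rˣ := if h : IsUnit x then h.unit else 1

/-- The factor `T`: the symbol of `1 - a * u ^ j * t ^ i`, `1 - b * u ^ l * t ^ k`,
`1 - c * u ^ n * t ^ m`, where `p = (i, j)`, `q = (k, l)`, `r = (m, n)`. -/
noncomputable def factorT (p q r : ℤ × ℤ) (a b c : R) : Rˣ :=
  let p₀ := det q r
  let q₀ := det r p
  let r₀ := det p q
  let d : ℕ := Nat.gcd p₀.natAbs (Nat.gcd q₀.natAbs r₀.natAbs)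
  let x : Rˣ := toUnit (1 - a ^ (p₀.natAbs / d) * b ^ (q₀.natAbs / d) * c ^ (r₀.natAbs / d))
  if 0 < p₀ ∧ 0 < q₀ ∧ 0 < r₀ then x ^ (d : ℤ)
  else if p₀ < 0 ∧ q₀ < 0 ∧ r₀ < 0 then x ^ (-(d : ℤ))
  else 1

/-- The factor `S`: the symbol of `1 - a * u ^ j * t ^ i`, `1 - b * u ^ l * t ^ k`, `t`,
where `p = (i, j)`, `q = (k, l)`. -/
noncomputable def factorS (p q : ℤ × ℤ) (a b : R) : Rˣ :=
  let d : ℕ := Int.gcd p.2 q.2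
  if det p q = 0 ∧ p.2 * q.2 + p.1 * q.1 < 0 ∧ p.2 * q.2 ≠ 0 then
    toUnit (1 - a ^ (q.2.natAbs / d) * b ^ (p.2.natAbs / d)) ^ (-(q.2.sign * (d : ℤ)))
  else 1

/-- The factor `Q`: the symbol of `1 - a * u ^ j * t ^ i`, `1 - b * u ^ l * t ^ k`, `u`,
where `p = (i, j)`, `q = (k, l)`. -/
noncomputable def factorQ (p q : ℤ × ℤ) (a b : R) : Rˣ :=
  let d : ℕ := Int.gcd p.1 q.1
  if det p q = 0 ∧ p.2 * q.2 + p.1 * q.1 < 0 ∧ p.1 * q.1 ≠ 0 then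
    toUnit (1 - a ^ (q.1.natAbs / d) * b ^ (p.1.natAbs / d)) ^ (q.1.sign * (d : ℤ))
  else 1

/-- All factors `T` of three families of coefficients. -/
noncomputable def famT (a b c : ℤ × ℤ → R) (x : (ℤ × ℤ) × (ℤ × ℤ) × (ℤ × ℤ)) : Rˣ :=
  factorT x.1 x.2.1 x.2.2 (a x.1) (b x.2.1) (c x.2.2)

/-- All factors `S` of two families of coefficients. -/
noncomputable def famS (a b : ℤ × ℤ → R) (x : (ℤ × ℤ) × (ℤ × ℤ)) : Rˣ :=
  factorS x.1 x.2 (a x.1) (b x.2)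

/-- All factors `Q` of two families of coefficients. -/
noncomputable def famQ (a b : ℤ × ℤ → R) (x : (ℤ × ℤ) × (ℤ × ℤ)) : Rˣ :=
  factorQ x.1 x.2 (a x.1) (b x.2)

namespace Decomposition

variable {f g h : DoubleLaurent R}

/-- The pair of valuations `(ν₁, ν₂)`. -/
def ν (F : Decomposition f) : ℤ × ℤ := (F.ν₁, F.ν₂)

/-- The infinite products in the explicit formula have only finitely many factors `≠ 1`. -/
def FiniteFactors (F : Decomposition f) (G : Decomposition g) (H : Decomposition h) : Prop :=
  (mulSupport (famT F.a G.a H.a)).Finite ∧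
  (mulSupport (famS F.a G.a)).Finite ∧ (mulSupport (famQ F.a G.a)).Finite ∧
  (mulSupport (famS H.a F.a)).Finite ∧ (mulSupport (famQ H.a F.a)).Finite ∧
  (mulSupport (famS G.a H.a)).Finite ∧ (mulSupport (famQ G.a H.a)).Finite

/-- The explicit formula for the symbol. (A factor with an index `(0, 0)` equals `1`.) -/
noncomputable def symbol (F : Decomposition f) (G : Decomposition g) (H : Decomposition h) : Rˣ :=
  (-1) ^ signExp F.ν G.ν H.ν *
    (F.unit ^ det G.ν H.ν * G.unit ^ det H.ν F.ν * H.unit ^ det F.ν G.ν) *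
    (∏ᶠ x, famT F.a G.a H.a x) *
    ((∏ᶠ x, famS F.a G.a x ^ H.ν₁) * (∏ᶠ x, famQ F.a G.a x ^ H.ν₂)) *
    ((∏ᶠ x, famS H.a F.a x ^ G.ν₁) * (∏ᶠ x, famQ H.a F.a x ^ G.ν₂)) *
    ((∏ᶠ x, famS G.a H.a x ^ F.ν₁) * (∏ᶠ x, famQ G.a H.a x ^ F.ν₂))

end Decomposition

/-- `c` is a value of the explicit formula at `(f, g, h)`. -/
def IsSymbolValue (f g h : (DoubleLaurent R)ˣ) (c : Rˣ) : Prop :=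
  ∃ (F : Decomposition (f : DoubleLaurent R)) (G : Decomposition (g : DoubleLaurent R))
    (H : Decomposition (h : DoubleLaurent R)), F.FiniteFactors G H ∧ c = F.symbol G H

/-- The two-dimensional Contou-Carrère symbol `(f, g, h)`. It is defined by the explicit formula
where `∃! c, IsSymbolValue f g h c`. -/
noncomputable def symbol (f g h : (DoubleLaurent R)ˣ) : Rˣ :=
  Classical.epsilon (IsSymbolValue f g h)

end Symbol

section Tame

variable {k : Type*} [Field k]

/-- The rank two valuation `(ν₁, ν₂)` of `x ∈ k((u))((t))ˣ`: the order of `x` in `t`, and the order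
in `u` of the leading coefficient. -/
noncomputable def val (x : DoubleLaurent k) : ℤ × ℤ := (x.order, x.leadingCoeff.order)

/-- The two-dimensional tame symbol: the sign times
`f ^ ν(g, h) * g ^ ν(h, f) * h ^ ν(f, g)` reduced modulo `t` and then modulo `u`. -/
noncomputable def tameSymbol (f g h : (DoubleLaurent k)ˣ) : k :=
  let vf := val (f : DoubleLaurent k)
  let vg := val (g : DoubleLaurent k)
  let vh := val (h : DoubleLaurent k)
  let w : (DoubleLaurent k)ˣ := f ^ det vg vh * g ^ det vh vf * h ^ det vf vg
  (((-1 : kˣ) ^ signExp vf vg vh : kˣ) : k) * ((w : DoubleLaurent k).coeff 0).coeff 0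

end Tame

section Residue

variable {k : Type*} [Field k]

/-- `∂/∂t` on `k((u))((t))`. -/
noncomputable def derivT (x : DoubleLaurent k) : DoubleLaurent k := LaurentSeries.derivative k x

/-- `∂/∂u` on `k((u))((t))`: the derivative of every coefficient. -/
noncomputable def derivU (x : DoubleLaurent k) : DoubleLaurent k :=
  HahnSeries.map x (LaurentSeries.derivative k : LaurentSeries k →ₗ[k] LaurentSeries k)

/-- `Res (f dg ∧ dh)`: the coefficient of `u⁻¹ t⁻¹ du ∧ dt`. -/
noncomputable def resWedge (f g h : DoubleLaurent k) : k :=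
  ((f * (derivU g * derivT h - derivU h * derivT g)).coeff (-1)).coeff (-1)

/-- `k[ε]/ε⁴`. -/
abbrev Trunc (k : Type*) [Field k] : Type _ := AdjoinRoot (Polynomial.X ^ 4 : Polynomial k)

/-- The class of `ε` in `k[ε]/ε⁴`. -/
noncomputable def eps (k : Type*) [Field k] : Trunc k := AdjoinRoot.root _

/-- The inclusion `k((u))((t)) → (k[ε]/ε⁴)((u))((t))`, coefficient by coefficient. -/
noncomputable def extend (x : DoubleLaurent k) : DoubleLaurent (Trunc k) where
  coeff i := HahnSeries.map (x.coeff i) (algebraMap k (Trunc k))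
  isPWO_support' := x.isPWO_support.mono fun i hi h0 => hi (by
    ext j
    simp [show x.coeff i = 0 from h0])

theorem eps_pow_four (k : Type*) [Field k] : eps k ^ 4 = 0 := by
  have h := AdjoinRoot.eval₂_root (Polynomial.X ^ 4 : Polynomial k)
  simpa [eps] using h

theorem isNilpotent_eps_mul (x : DoubleLaurent (Trunc k)) :
    IsNilpotent (HahnSeries.C (HahnSeries.C (eps k)) * x) :=
  ⟨4, by rw [mul_pow, ← map_pow, ← map_pow, eps_pow_four]; simp⟩

/-- The invertible element `1 + ε f` of `(k[ε]/ε⁴)((u))((t))`, for `f ∈ k((u))((t))`. -/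
noncomputable def oneAddEps (f : DoubleLaurent k) : (DoubleLaurent (Trunc k))ˣ :=
  (isNilpotent_eps_mul (extend f)).isUnit_one_add.unit

end Residue

end ContouCarrere

/-! In both parts the explicit formula is evaluated on arbitrary decompositions and its value is
seen to depend only on the series. So uniqueness of decompositions is never needed: existence,
finiteness of the products and the evaluation give well-definedness.

The vanishing principle (`exists_of_factorT_ne_one` and its analogues for S and Q) is that a
nontrivial factor forces a combination of its indices with positive integer weights to be 0, while
the monomial in the coefficients with these weights as exponents is nonzero.

Over a field nilpotents vanish, so only lexicographically positive indices carry nonzero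
coefficients, and a positive combination of positive elements is not 0. All T, S, Q are trivial. The
lowest term of f is f₀ u^ν₂ t^ν₁, so the pair ν is the rank two valuation and f₀ the iterated
leading coefficient. Both are multiplicative, and the product of powers in the tame symbol has
valuation 0, so its reduction is the same product of powers of the units (`tameSymbol_eq`).

Over k[ε]/ε⁴ put I = (ε), so I⁴ = 0. A decomposition of 1 + εf has ν = 0 and coefficients a_p ≡ -ε
f_p mod I² for p ≠ 0 (`of_sub_one_mem`). Hence the sign and the powers of units, S and Q disappear.
A nontrivial T has weights with sum less than 4, so all equal to 1: its indices p, q, r have sum 0,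
the three determinants coincide, and T = 1 - det(q, r) abc = 1 + ε³ det(q, r) f_p g_q h_r. The
product of these linearises to a sum, which is the residue (`resWedge_eq_finsum`).

Existence of decompositions: positive products are solved by recursion on a well-ordered set of
indices (`exists_hasInfiniteProduct_posIdx`), negative ones by successive approximation along the
powers of I (`exists_negIdx_factor`). -/

namespace ContouCarrere

open Function

/-! ### Coefficients of products of double Laurent series. -/

section Coefficients

variable {R : Type*} [CommRing R]

/-- The coefficient of `u ^ q.2 * t ^ q.1`. -/
noncomputable def cf (q : ℤ × ℤ) : DoubleLaurent R →+ R where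
  toFun x := (x.coeff q.1).coeff q.2
  map_zero' := by simp
  map_add' x y := by simp

theorem cf_apply (q : ℤ × ℤ) (x : DoubleLaurent R) : cf q x = (x.coeff q.1).coeff q.2 := rfl

theorem ext_cf {x y : DoubleLaurent R} (h : ∀ q, cf q x = cf q y) : x = y := by
  ext i j
  exact h (i, j)

theorem cf_mono (q : ℤ × ℤ) (i j : ℤ) (r : R) :
    cf q (mono i j r) = if q = (i, j) then r else 0 := by
  classical
  rw [cf_apply, mono, HahnSeries.coeff_single]
  by_cases h : q.1 = i
  · rw [if_pos h, HahnSeries.coeff_single]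
    by_cases h' : q.2 = j
    · rw [if_pos h', if_pos (Prod.ext h h')]
    · rw [if_neg h', if_neg (fun h'' => h' (by rw [h'']))]
  · rw [if_neg h, if_neg (fun h' => h (by rw [h']))]
    simp

theorem one_eq_mono : (1 : DoubleLaurent R) = mono 0 0 1 := rfl

theorem cf_one (q : ℤ × ℤ) : cf q (1 : DoubleLaurent R) = if q = 0 then 1 else 0 :=
  cf_mono q 0 0 1

theorem mono_mul_mono (i j k l : ℤ) (r s : R) :
    mono i j r * mono k l s = mono (i + k) (j + l) (r * s) := by
  simp [mono, HahnSeries.single_mul_single]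

theorem mono_zero (i j : ℤ) : mono i j (0 : R) = 0 := by simp [mono]

theorem mono_neg (i j : ℤ) (r : R) : mono i j (-r) = -mono i j r := by simp [mono]

theorem prod_mono (T : Finset (ℤ × ℤ)) (a : ℤ × ℤ → R) :
    ∏ p ∈ T, mono p.1 p.2 (a p) = mono (∑ p ∈ T, p).1 (∑ p ∈ T, p).2 (∏ p ∈ T, a p) := by
  induction T using Finset.cons_induction with
  | empty => exact one_eq_mono
  | cons p T hp ih => simp only [Finset.prod_cons, Finset.sum_cons, ih, mono_mul_mono, Prod.fst_add,
      Prod.snd_add]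

theorem cf_mono_mul (q : ℤ × ℤ) (i j : ℤ) (r : R) (x : DoubleLaurent R) :
    cf q (mono i j r * x) = r * cf (q - (i, j)) x := by
  have := HahnSeries.coeff_single_mul (r := HahnSeries.single j r) (x := x) (a := q.1) (b := i)
  rw [cf_apply, mono, this, HahnSeries.coeff_single_mul]
  rfl

/-- The coefficients of a finite product of factors `1 - a p * u ^ p.2 * t ^ p.1`. -/
theorem cf_prod_one_sub (S : Finset (ℤ × ℤ)) (a : ℤ × ℤ → R) (q : ℤ × ℤ) :
    cf q (∏ p ∈ S, (1 - mono p.1 p.2 (a p))) =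
      ∑ T ∈ S.powerset with ∑ p ∈ T, p = q, (-1) ^ T.card * ∏ p ∈ T, a p := by
  have h : ∏ p ∈ S, (1 - mono p.1 p.2 (a p)) =
      ∑ T ∈ S.powerset, mono (∑ p ∈ T, p).1 (∑ p ∈ T, p).2 ((-1) ^ T.card * ∏ p ∈ T, a p) := by
    simp_rw [sub_eq_neg_add, Finset.prod_add, Finset.prod_const_one, mul_one]
    refine Finset.sum_congr rfl fun T _ => ?_
    simp_rw [← mono_neg]
    rw [prod_mono, Finset.prod_neg]
  rw [h, map_sum, Finset.sum_filter]
  refine Finset.sum_congr rfl fun T _ => ?_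
  rw [cf_mono]
  exact if_congr eq_comm rfl rfl

/-- An iterated Hahn series is a Hahn series over the lexicographic product. This is the source of
all finiteness statements below. -/
theorem isPWO_support_lex (x : DoubleLaurent R) : {q : ℤ ×ₗ ℤ | cf (ofLex q) x ≠ 0}.IsPWO :=
  (HahnSeries.ofIterate x).isPWO_support

theorem finite_addAntidiagonal_lex {s t : Set (ℤ × ℤ)} (hs : {q : ℤ ×ₗ ℤ | ofLex q ∈ s}.IsPWO)
    (ht : {q : ℤ ×ₗ ℤ | ofLex q ∈ t}.IsPWO) (q : ℤ × ℤ) : {p | p ∈ s ∧ q - p ∈ t}.Finite := by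
  refine ((Set.AddAntidiagonal.finite_of_isPWO hs ht (toLex q)).image
    fun z => ofLex z.1).subset ?_
  rintro p ⟨h1, h2⟩
  refine ⟨(toLex p, toLex (q - p)), ⟨h1, h2, ?_⟩, rfl⟩
  rw [← toLex_add, add_sub_cancel]

theorem finite_support_conv (x y : DoubleLaurent R) (q : ℤ × ℤ) :
    {p | cf p x ≠ 0 ∧ cf (q - p) y ≠ 0}.Finite :=
  finite_addAntidiagonal_lex (s := {p | cf p x ≠ 0}) (t := {p | cf p y ≠ 0})
    (isPWO_support_lex x) (isPWO_support_lex y) q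

theorem coeff_mul_eq_finsum {A : Type*} [CommRing A] (x y : LaurentSeries A) (i : ℤ) :
    (x * y).coeff i = ∑ᶠ a, x.coeff a * y.coeff (i - a) := by
  rw [HahnSeries.coeff_mul, finsum_eq_sum_of_support_subset (s := (Finset.antidiagonal
    x.isPWO_support y.isPWO_support i).image Prod.fst), Finset.sum_image]
  · refine Finset.sum_congr rfl fun z hz => ?_
    rw [← (Finset.mem_antidiagonal.1 hz).2.2, add_sub_cancel_left]
  · intro z hz w hw h
    have h1 := (Finset.mem_antidiagonal.1 hz).2.2
    have h2 := (Finset.mem_antidiagonal.1 hw).2.2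
    exact Prod.ext h (by linarith [show z.1 = w.1 from h])
  · intro a ha
    rw [mem_support] at ha
    refine Finset.mem_coe.2 (Finset.mem_image.2 ⟨(a, i - a), ?_, rfl⟩)
    exact Finset.mem_antidiagonal.2 ⟨left_ne_zero_of_mul ha, right_ne_zero_of_mul ha, by simp⟩

/-- The two nested convolutions merge into one finite sum over ℤ², because the joint support is
finite. -/
theorem cf_mul (x y : DoubleLaurent R) (q : ℤ × ℤ) :
    cf q (x * y) = ∑ᶠ p, cf p x * cf (q - p) y := by
  have hfin : (support fun p => cf p x * cf (q - p) y).Finite :=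
    (finite_support_conv x y q).subset fun p hp =>
      ⟨left_ne_zero_of_mul hp, right_ne_zero_of_mul hp⟩
  rw [finsum_curry _ hfin, cf_apply, coeff_mul_eq_finsum]
  have hfin' : (support fun a => x.coeff a * y.coeff (q.1 - a)).Finite := by
    refine (Set.AddAntidiagonal.finite_of_isPWO x.isPWO_support y.isPWO_support q.1).image
      Prod.fst |>.subset fun a ha => ⟨(a, q.1 - a), ⟨left_ne_zero_of_mul ha,
        right_ne_zero_of_mul ha, by simp⟩, rfl⟩
  refine ((HahnSeries.coeff.addMonoidHom (Γ := ℤ) (R := R) q.2).map_finsum hfin').trans ?_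
  exact finsum_congr fun a => coeff_mul_eq_finsum _ _ _

/-- The series whose coefficients all lie in an ideal of the ring of constants. -/
def coeffIdeal (I : Ideal R) : Ideal (DoubleLaurent R) where
  carrier := {x | ∀ q, cf q x ∈ I}
  zero_mem' q := by simp
  add_mem' hx hy q := by rw [map_add]; exact I.add_mem (hx q) (hy q)
  smul_mem' c x hx q := by
    rw [smul_eq_mul, cf_mul]
    exact finsum_induction (· ∈ I) I.zero_mem (fun _ _ => I.add_mem)
      fun p => I.mul_mem_left _ (hx _)

theorem mul_mem_coeffIdeal {I J K : Ideal R} (h : I * J ≤ K) {x y : DoubleLaurent R}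
    (hx : x ∈ coeffIdeal I) (hy : y ∈ coeffIdeal J) : x * y ∈ coeffIdeal K := fun q => by
  rw [cf_mul]
  exact finsum_induction (· ∈ K) K.zero_mem (fun _ _ => K.add_mem)
    fun p => h (Ideal.mul_mem_mul (hx _) (hy _))

end Coefficients

/-! ### Lexicographic positivity and well-ordered index sets. -/

section Lex

theorem mem_posIdx_iff {q : ℤ × ℤ} : q ∈ posIdx ↔ 0 < toLex q := by
  rw [Prod.Lex.lt_iff]
  simp [posIdx, eq_comm]

theorem mem_negIdx_iff {q : ℤ × ℤ} : q ∈ negIdx ↔ toLex q < 0 := by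
  rw [Prod.Lex.lt_iff]
  simp [negIdx]

theorem toLex_lt_toLex_iff {p q : ℤ × ℤ} : toLex p < toLex q ↔ q - p ∈ posIdx := by
  rw [mem_posIdx_iff, toLex_sub, sub_pos]

theorem mem_negIdx_or_eq_zero_or_mem_posIdx (q : ℤ × ℤ) : q ∈ negIdx ∨ q = 0 ∨ q ∈ posIdx := by
  rw [mem_posIdx_iff, mem_negIdx_iff]
  exact lt_trichotomy (toLex q) 0

theorem zero_notMem_posIdx : (0 : ℤ × ℤ) ∉ posIdx := by simp [posIdx]

theorem zero_notMem_negIdx : (0 : ℤ × ℤ) ∉ negIdx := by simp [negIdx]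

theorem notMem_posIdx_of_mem_negIdx {q : ℤ × ℤ} (h : q ∈ negIdx) : q ∉ posIdx := by
  rw [mem_posIdx_iff]
  exact (mem_negIdx_iff.1 h).not_gt

theorem add_mem_posIdx {p q : ℤ × ℤ} (hp : p ∈ posIdx) (hq : q ∈ posIdx) : p + q ∈ posIdx := by
  rw [mem_posIdx_iff] at *
  exact add_pos hp hq

theorem sum_mem_posIdx {T : Finset (ℤ × ℤ)} (hT : T.Nonempty) (h : ∀ p ∈ T, p ∈ posIdx) :
    ∑ p ∈ T, p ∈ posIdx := by
  induction hT using Finset.Nonempty.cons_induction with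
  | singleton p => simpa using h
  | cons p T hp hT ih =>
    rw [Finset.sum_cons]
    exact add_mem_posIdx (h p (by simp)) (ih fun q hq => h q (by simp [hq]))

/-- The difference is the sum of the remaining elements, which are positive and exist unless T is a
singleton. Hence recursions on the total only call smaller indices. -/
theorem sum_sub_mem_posIdx {T : Finset (ℤ × ℤ)} (h : ∀ p ∈ T, p ∈ posIdx) {p : ℤ × ℤ}
    (hp : p ∈ T) (hT : T ≠ {∑ p ∈ T, p}) : ∑ p ∈ T, p - p ∈ posIdx := by
  have hs := Finset.add_sum_erase T (fun p => p) hp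
  rcases (T.erase p).eq_empty_or_nonempty with he | hne
  · rw [he, Finset.sum_empty, add_zero] at hs
    refine absurd ?_ hT
    rw [← hs]
    exact (Finset.erase_eq_empty_iff T p).1 he |>.resolve_left (Finset.ne_empty_of_mem hp)
  · rw [← hs, add_sub_cancel_left]
    exact sum_mem_posIdx hne fun q hq => h q (Finset.mem_of_mem_erase hq)

/-- A partially well ordered set meets the complement of a basic neighbourhood of zero in a finite
set. -/
theorem finite_inter_region {V : Set (ℤ × ℤ)} (hV : {q : ℤ ×ₗ ℤ | ofLex q ∈ V}.IsPWO) (m : ℤ)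
    (n : ℤ → ℤ) : {q | q ∈ V ∧ q.1 < m ∧ q.2 < n q.1}.Finite := by
  rcases V.eq_empty_or_nonempty with rfl | ⟨v, hv⟩
  · simp
  have hne : {q : ℤ ×ₗ ℤ | ofLex q ∈ V}.Nonempty := ⟨toLex v, hv⟩
  have h1 : ∀ q ∈ V, (ofLex (hV.isWF.min hne)).1 ≤ q.1 := fun q hq => by
    rcases (Prod.Lex.le_iff.1 (hV.isWF.min_le hne (a := toLex q) hq)) with h | h
    · exact h.le
    · exact h.1.le
  have h2 : ∀ i, ∃ b, ∀ q ∈ V, q.1 = i → b ≤ q.2 := fun i => by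
    by_cases hi : ∃ q ∈ V, q.1 = i
    · obtain ⟨q, hq, hqi⟩ := hi
      have hwf : {q : ℤ ×ₗ ℤ | ofLex q ∈ V ∧ (ofLex q).1 = i}.IsWF :=
        hV.isWF.mono fun q hq => hq.1
      have hne' : {q : ℤ ×ₗ ℤ | ofLex q ∈ V ∧ (ofLex q).1 = i}.Nonempty := ⟨toLex q, hq, hqi⟩
      refine ⟨(ofLex (hwf.min hne')).2, fun p hp hpi => ?_⟩
      have hmin : (ofLex (hwf.min hne')).1 = i := (hwf.min_mem hne').2
      rcases (Prod.Lex.le_iff.1 (hwf.min_le hne' (a := toLex p) ⟨hp, hpi⟩)) with h | h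
      · rw [hmin] at h
        exact absurd h (by simp [hpi])
      · exact h.2
    · exact ⟨0, fun q hq hqi => absurd ⟨q, hq, hqi⟩ hi⟩
  choose b hb using h2
  refine (Set.Finite.biUnion (Set.finite_Ico (ofLex (hV.isWF.min hne)).1 m)
    fun i _ => (Set.finite_singleton i).prod (Set.finite_Ico (b i) (n i))).subset ?_
  rintro q ⟨hq, hqm, hqn⟩
  exact Set.mem_biUnion (Set.mem_Ico.2 ⟨h1 q hq, hqm⟩) ⟨rfl, hb _ q hq rfl, hqn⟩

end Lex

/-! ### Convergence and existence of infinite products. -/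

section Convergence

variable {R : Type*} [CommRing R] {s : Set (ℤ × ℤ)} {a b : ℤ × ℤ → R} {x : DoubleLaurent R}

theorem HasInfiniteProduct.congr (hab : ∀ p ∈ s, a p = b p) (h : HasInfiniteProduct s a x) :
    HasInfiniteProduct s b x := fun m n => by
  obtain ⟨S, hS, h⟩ := h m n
  refine ⟨S, hS, fun S' hSS' hS' => ?_⟩
  have : ∏ p ∈ S', (1 - mono p.1 p.2 (b p)) = ∏ p ∈ S', (1 - mono p.1 p.2 (a p)) :=
    Finset.prod_congr rfl fun p hp => by rw [hab p (hS' hp)]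
  rw [this]
  exact h S' hSS' hS'

theorem HasInfiniteProduct.exists_forall_cf_eq (h : HasInfiniteProduct s a x) (q : ℤ × ℤ) :
    ∃ S : Finset (ℤ × ℤ), (S : Set (ℤ × ℤ)) ⊆ s ∧
      ∀ S' : Finset (ℤ × ℤ), S ⊆ S' → (S' : Set (ℤ × ℤ)) ⊆ s →
        cf q x = cf q (∏ p ∈ S', (1 - mono p.1 p.2 (a p))) := by
  -- The inequalities in `InNbhd` are strict, so adding 1 makes the neighbourhood control the
  -- coefficient at q itself.
  obtain ⟨S, hS, h⟩ := h (q.1 + 1) fun _ => q.2 + 1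
  refine ⟨S, hS, fun S' hSS' hS' => ?_⟩
  have := h S' hSS' hS' q.1 (by simp) q.2 (by simp)
  rw [← cf_apply, map_sub, sub_eq_zero] at this
  exact this.symm

theorem HasInfiniteProduct.exists_cf_eq (h : HasInfiniteProduct s a x) (q : ℤ × ℤ)
    {A : Finset (ℤ × ℤ)} (hA : (A : Set (ℤ × ℤ)) ⊆ s) :
    ∃ S : Finset (ℤ × ℤ), A ⊆ S ∧ (S : Set (ℤ × ℤ)) ⊆ s ∧
      cf q x = cf q (∏ p ∈ S, (1 - mono p.1 p.2 (a p))) := by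
  classical
  obtain ⟨S, hS, h⟩ := h.exists_forall_cf_eq q
  have hu : ((S ∪ A : Finset (ℤ × ℤ)) : Set (ℤ × ℤ)) ⊆ s := by
    rw [Finset.coe_union]
    exact Set.union_subset hS hA
  exact ⟨S ∪ A, Finset.subset_union_right, hu, h _ Finset.subset_union_left hu⟩

theorem hasInfiniteProduct_one (h : ∀ p ∈ s, a p = 0) : HasInfiniteProduct s a 1 := by
  refine fun m n => ⟨∅, by simp, fun S _ hS i _ j _ => ?_⟩
  rw [Finset.prod_eq_one fun p hp => by rw [h p (hS hp), mono_zero, sub_zero]]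
  simp

theorem cf_prod_eq_sum {S : Finset (ℤ × ℤ)} {q : ℤ × ℤ} {F : Finset (Finset (ℤ × ℤ))}
    (hF : ∀ T ∈ F, ∏ p ∈ T, a p ≠ 0 → T ⊆ S ∧ ∑ p ∈ T, p = q)
    (hS : ∀ T ⊆ S, ∏ p ∈ T, a p ≠ 0 → ∑ p ∈ T, p = q → T ∈ F) :
    cf q (∏ p ∈ S, (1 - mono p.1 p.2 (a p))) = ∑ T ∈ F, (-1) ^ T.card * ∏ p ∈ T, a p := by
  classical
  rw [cf_prod_one_sub, ← Finset.sum_filter_ne_zero, ← Finset.sum_filter_ne_zero (s := F)]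
  refine Finset.sum_congr ?_ fun _ _ => rfl
  ext T
  simp only [Finset.mem_filter, Finset.mem_powerset]
  exact ⟨fun h => ⟨hS T h.1.1 (right_ne_zero_of_mul h.2) h.1.2, h.2⟩,
    fun h => ⟨hF T h.1 (right_ne_zero_of_mul h.2), h.2⟩⟩

/-- Expanding a finite product gives one term for each subset T of indices, placed at the sum of T.
If all nonzero terms in the region cut out by a neighbourhood use only indices of a finite B, the
coefficients there no longer change once B is included. -/
theorem hasInfiniteProduct_of_box
    (hbox : ∀ (m : ℤ) (n : ℤ → ℤ), ∃ B : Finset (ℤ × ℤ), (B : Set (ℤ × ℤ)) ⊆ s ∧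
      ∀ T : Finset (ℤ × ℤ), (T : Set (ℤ × ℤ)) ⊆ s → ∏ p ∈ T, a p ≠ 0 →
        (∑ p ∈ T, p).1 < m → (∑ p ∈ T, p).2 < n (∑ p ∈ T, p).1 → T ⊆ B)
    (hx : ∀ (q : ℤ × ℤ) (B : Finset (ℤ × ℤ)), (B : Set (ℤ × ℤ)) ⊆ s →
      (∀ T : Finset (ℤ × ℤ), (T : Set (ℤ × ℤ)) ⊆ s → ∏ p ∈ T, a p ≠ 0 → ∑ p ∈ T, p = q → T ⊆ B) →
      cf q (∏ p ∈ B, (1 - mono p.1 p.2 (a p))) = cf q x) :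
    HasInfiniteProduct s a x := fun m n => by
  obtain ⟨B, hB, h⟩ := hbox m n
  refine ⟨B, hB, fun S hBS hS i hi j hj => ?_⟩
  rw [← cf_apply (i, j), map_sub, sub_eq_zero]
  refine hx (i, j) S hS fun T hT hT0 hTq => (h T hT hT0 ?_ ?_).trans hBS
  · rwa [hTq]
  · rwa [hTq]

theorem exists_of_bounded (c : ℤ × ℤ → R) (i₀ j₀ : ℤ) (h : ∀ q, c q ≠ 0 → i₀ ≤ q.1 ∧ j₀ ≤ q.2) :
    ∃ x : DoubleLaurent R, ∀ q, cf q x = c q := by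
  have h1 : ∀ i, BddBelow (support fun j => c (i, j)) := fun i => ⟨j₀, fun j hj => (h _ hj).2⟩
  refine ⟨HahnSeries.ofSuppBddBelow (fun i => HahnSeries.ofSuppBddBelow (fun j => c (i, j)) (h1 i))
    ⟨i₀, fun i hi => ?_⟩, fun q => rfl⟩
  by_contra hlt
  refine hi (HahnSeries.ofSuppBddBelow_eq_zero.2 (funext fun j => ?_))
  by_contra h0
  exact hlt (h _ h0).1

/-- Convergence of the product over the negative indices. -/
theorem exists_hasInfiniteProduct_negIdx {i₀ j₀ : ℤ}
    (hb : ∀ p ∈ negIdx, a p ≠ 0 → i₀ < p.1 ∧ j₀ < p.2) {N : ℕ}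
    (hN : ∀ T : Finset (ℤ × ℤ), (T : Set (ℤ × ℤ)) ⊆ negIdx → ∏ p ∈ T, a p ≠ 0 → T.card ≤ N) :
    ∃ x, HasInfiniteProduct negIdx a x := by
  classical
  have hmem : ∀ T : Finset (ℤ × ℤ), (T : Set (ℤ × ℤ)) ⊆ negIdx → ∏ p ∈ T, a p ≠ 0 → ∀ p ∈ T,
      i₀ < p.1 ∧ j₀ < p.2 := fun T hT h0 p hp =>
    hb p (hT hp) fun h => h0 (Finset.prod_eq_zero hp h)
  have hle : ∀ (c : ℤ) (k : ℕ), k ≤ N → -(N * |c|) ≤ k * -|c| := fun c k hk => by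
    have : (k : ℤ) ≤ N := by exact_mod_cast hk
    nlinarith [abs_nonneg c]
  -- Nonzero terms use at most N indices, each bounded below, so all partial sums are bounded below
  -- too.
  have hsum : ∀ T : Finset (ℤ × ℤ), (T : Set (ℤ × ℤ)) ⊆ negIdx → ∏ p ∈ T, a p ≠ 0 → ∀ U ⊆ T,
      -(N * |i₀|) ≤ (∑ p ∈ U, p).1 ∧ -(N * |j₀|) ≤ (∑ p ∈ U, p).2 := by
    intro T hT h0 U hU
    rw [Prod.fst_sum, Prod.snd_sum]
    have hcard : U.card ≤ N := (Finset.card_le_card hU).trans (hN T hT h0)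
    constructor
    · refine (hle i₀ _ hcard).trans ?_
      rw [← nsmul_eq_mul]
      exact Finset.card_nsmul_le_sum _ _ _ fun p hp =>
        (neg_abs_le i₀).trans (hmem T hT h0 p (hU hp)).1.le
    · refine (hle j₀ _ hcard).trans ?_
      rw [← nsmul_eq_mul]
      exact Finset.card_nsmul_le_sum _ _ _ fun p hp =>
        (neg_abs_le j₀).trans (hmem T hT h0 p (hU hp)).2.le
  have hbox : ∀ (m : ℤ) (n : ℤ → ℤ), ∃ B : Finset (ℤ × ℤ), (B : Set (ℤ × ℤ)) ⊆ negIdx ∧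
      ∀ T : Finset (ℤ × ℤ), (T : Set (ℤ × ℤ)) ⊆ negIdx → ∏ p ∈ T, a p ≠ 0 →
        (∑ p ∈ T, p).1 < m → (∑ p ∈ T, p).2 < n (∑ p ∈ T, p).1 → T ⊆ B := by
    intro m n
    -- The first coordinate of a contributing total lies in a finite interval, on which n is bounded
    -- by M. Subtracting the other indices, whose sum is at least -N|j₀|, bounds each second
    -- coordinate by M + N|j₀|.
    obtain ⟨M, hM⟩ := ((Set.finite_Icc (-(N * |i₀|)) 0).image n).bddAbove
    refine ⟨(Finset.Icc i₀ 0 ×ˢ Finset.Icc j₀ (M + N * |j₀|)).filter (· ∈ negIdx),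
      fun p hp => (Finset.mem_filter.1 hp).2, fun T hT h0 _ h2 p hp => ?_⟩
    have hneg : ∀ p ∈ T, p.1 ≤ 0 := fun p hp => by
      rcases hT hp with h | h
      · exact h.le
      · exact h.1.le
    have hs1 : (∑ p ∈ T, p).1 ≤ 0 := by
      rw [Prod.fst_sum]
      exact Finset.sum_nonpos hneg
    have hnM : n (∑ p ∈ T, p).1 ≤ M :=
      hM (Set.mem_image_of_mem n ⟨(hsum T hT h0 T subset_rfl).1, hs1⟩)
    have he := (hsum T hT h0 _ (Finset.erase_subset p T)).2
    have hs2 : (∑ p ∈ T, p).2 = p.2 + (∑ p ∈ T.erase p, p).2 := by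
      rw [← Prod.snd_add, Finset.add_sum_erase T (fun p => p) hp]
    have hp' := hmem T hT h0 p hp
    simp only [Finset.mem_filter, Finset.mem_product, Finset.mem_Icc]
    refine ⟨⟨⟨hp'.1.le, hneg p hp⟩, hp'.2.le, by linarith⟩, hT hp⟩
  choose B hB hBT using fun q : ℤ × ℤ => hbox (q.1 + 1) fun _ => q.2 + 1
  have hBT' : ∀ (q : ℤ × ℤ) (T : Finset (ℤ × ℤ)), (T : Set (ℤ × ℤ)) ⊆ negIdx → ∏ p ∈ T, a p ≠ 0 → ∑ p ∈ T, p = q →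
      T ⊆ B q := fun q T hT h0 hq => hBT q T hT h0 (by simp [hq]) (by simp [hq])
  obtain ⟨x, hx⟩ := exists_of_bounded (fun q => cf q (∏ p ∈ B q, (1 - mono p.1 p.2 (a p))))
    (-(N * |i₀|)) (-(N * |j₀|)) (by
      intro q hq
      rw [cf_prod_one_sub] at hq
      obtain ⟨T, hT, h0⟩ := Finset.exists_ne_zero_of_sum_ne_zero hq
      simp only [Finset.mem_filter, Finset.mem_powerset] at hT
      rw [← hT.2]
      exact hsum T ((Finset.coe_subset.2 hT.1).trans (hB q)) (right_ne_zero_of_mul h0) T subset_rfl)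
  refine ⟨x, hasInfiniteProduct_of_box hbox fun q S hS hST => ?_⟩
  rw [hx, cf_prod_one_sub (B q)]
  refine cf_prod_eq_sum (fun T hT h0 => ?_) fun T hT h0 hq => ?_
  · simp only [Finset.mem_filter, Finset.mem_powerset] at hT
    exact ⟨hST T ((Finset.coe_subset.2 hT.1).trans (hB q)) h0 hT.2, hT.2⟩
  · simp only [Finset.mem_filter, Finset.mem_powerset]
    exact ⟨hBT' q T ((Finset.coe_subset.2 hT).trans hS) h0 hq, hq⟩

/-- Every series with constant coefficient `1` and no terms below it is an infinite product over
the positive indices. -/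
theorem exists_hasInfiniteProduct_posIdx (x : DoubleLaurent R) (h0 : cf 0 x = 1)
    (hneg : ∀ q ∈ negIdx, cf q x = 0) : ∃ a, HasInfiniteProduct posIdx a x := by
  classical
  set G : Set (ℤ ×ₗ ℤ) := {q | cf (ofLex q) (x - 1) ≠ 0} with hG
  have hGpos : ∀ q ∈ G, 0 ≤ q := by
    intro q hq
    by_contra hlt
    have hq' : ofLex q ∈ negIdx := mem_negIdx_iff.2 (not_le.1 hlt)
    refine hq ?_
    rw [map_sub, hneg _ hq', cf_one, if_neg, sub_zero]
    rintro h
    rw [h] at hq'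
    exact zero_notMem_negIdx hq'
  -- The monoid generated by the support of x - 1 is still partially well ordered, and the exponents
  -- needed for the product all lie in it.
  have hCP : (AddSubmonoid.closure G : Set (ℤ ×ₗ ℤ)).IsPWO :=
    (isPWO_support_lex (x - 1)).addSubmonoid_closure hGpos
  have hCpos : ∀ q ∈ AddSubmonoid.closure G, 0 ≤ q := fun q hq =>
    AddSubmonoid.closure_induction (fun q hq => hGpos q hq) le_rfl
      (fun _ _ _ _ => add_nonneg) hq
  set C : Set (ℤ × ℤ) := {q | toLex q ∈ AddSubmonoid.closure G} with hC
  have hCfin : ∀ q, {p | p ∈ C ∧ q - p ∈ C}.Finite := finite_addAntidiagonal_lex hCP hCP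
  have hCsum : ∀ T : Finset (ℤ × ℤ), (T : Set (ℤ × ℤ)) ⊆ C → ∑ p ∈ T, p ∈ C := by
    intro T hT
    induction T using Finset.cons_induction with
    | empty => exact (AddSubmonoid.closure G).zero_mem
    | cons p T hp ih =>
      rw [Finset.sum_cons]
      rw [Finset.coe_cons, Set.insert_subset_iff] at hT
      exact (AddSubmonoid.closure G).add_mem hT.1 (ih hT.2)
  have hCsub : ∀ T : Finset (ℤ × ℤ), (T : Set (ℤ × ℤ)) ⊆ C → ∀ p ∈ T,
      p ∈ C ∧ ∑ p ∈ T, p - p ∈ C := by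
    intro T hT p hp
    refine ⟨hT hp, ?_⟩
    rw [← Finset.add_sum_erase T (fun p => p) hp, add_sub_cancel_left]
    exact hCsum _ ((Finset.coe_subset.2 (Finset.erase_subset p T)).trans hT)
  set W : Set (ℤ × ℤ) := C ∩ posIdx with hW
  have hCW : ∀ q ∈ C, q ≠ 0 → q ∈ W := fun q hq hq0 =>
    ⟨hq, mem_posIdx_iff.2 (lt_of_le_of_ne (hCpos _ hq) fun h => hq0 (congrArg ofLex h).symm)⟩
  have hfin : ∀ q, {T : Finset (ℤ × ℤ) | (T : Set (ℤ × ℤ)) ⊆ W ∧ ∑ p ∈ T, p = q}.Finite := by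
    refine fun q => ((hCfin q).toFinset.powerset.finite_toSet).subset ?_
    rintro T ⟨hT, rfl⟩
    refine Finset.mem_coe.2 (Finset.mem_powerset.2 fun p hp => ?_)
    exact (Set.Finite.mem_toFinset _).2 (hCsub T (hT.trans Set.inter_subset_left) p hp)
  set F : ℤ × ℤ → Finset (Finset (ℤ × ℤ)) := fun q => (hfin q).toFinset with hF
  have hmemF : ∀ q T, T ∈ F q ↔ (T : Set (ℤ × ℤ)) ⊆ W ∧ ∑ p ∈ T, p = q := fun q T =>
    Set.Finite.mem_toFinset _
  have hwf : WellFounded fun p q : ℤ × ℤ => toLex p < toLex q ∧ p ∈ W ∧ q ∈ W := by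
    have h1 : {q : ℤ ×ₗ ℤ | ofLex q ∈ W}.IsWF := (hCP.mono fun q hq => hq.1).isWF
    exact InvImage.wf toLex (Set.wellFoundedOn_iff.1 h1)
  -- Solve the coefficient equation at q for a q: the subset {q} contributes -a q, and every other
  -- subset with sum q involves only smaller indices. The inner default 0 is never reached.
  obtain ⟨a, ha⟩ : ∃ a : ℤ × ℤ → R, ∀ q, a q = if q ∈ W then
      -cf q x + ∑ T ∈ (F q).erase {q}, (-1) ^ T.card * ∏ p ∈ T, a p else 0 := by
    refine ⟨hwf.fix fun q rec => if q ∈ W then -cf q x + ∑ T ∈ (F q).erase {q},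
      (-1) ^ T.card * ∏ p ∈ T, (if h : toLex p < toLex q ∧ p ∈ W ∧ q ∈ W then rec p h else 0)
      else 0, fun q => ?_⟩
    rw [hwf.fix_eq]
    split_ifs with hq
    · congr 1
      refine Finset.sum_congr rfl fun T hT => ?_
      congr 1
      refine Finset.prod_congr rfl fun p hp => ?_
      obtain ⟨hTq, hT⟩ := Finset.mem_erase.1 hT
      obtain ⟨hTW, rfl⟩ := (hmemF q T).1 hT
      rw [dif_pos]
      exact ⟨toLex_lt_toLex_iff.2 (sum_sub_mem_posIdx (fun p hp => (hTW hp).2) hp hTq),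
        hTW hp, hq⟩
    · rfl
  have hTW : ∀ T : Finset (ℤ × ℤ), ∏ p ∈ T, a p ≠ 0 → (T : Set (ℤ × ℤ)) ⊆ W := by
    intro T hT p hp
    by_contra hpW
    exact hT (Finset.prod_eq_zero hp (by rw [ha, if_neg hpW]))
  refine ⟨a, hasInfiniteProduct_of_box (fun m n => ?_) fun q B hB hBT => ?_⟩
  · have hreg := finite_inter_region (V := C) hCP m n
    refine ⟨(hreg.biUnion fun q _ => (hCfin q)).toFinset.filter (· ∈ posIdx),
      fun p hp => (Finset.mem_filter.1 hp).2, fun T hT hT0 hm hn p hp => ?_⟩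
    have hTC := (hTW T hT0).trans Set.inter_subset_left
    refine Finset.mem_filter.2 ⟨(Set.Finite.mem_toFinset _).2 (Set.mem_biUnion
      (x := ∑ p ∈ T, p) ⟨hCsum T hTC, hm, hn⟩ (hCsub T hTC p hp)), hT hp⟩
  · rw [cf_prod_eq_sum (F := F q)]
    rotate_left
    · intro T hT hT0
      obtain ⟨hTW, hTq⟩ := (hmemF q T).1 hT
      exact ⟨hBT T (fun p hp => (hTW hp).2) hT0 hTq, hTq⟩
    · exact fun T _ hT0 hTq => (hmemF q T).2 ⟨hTW T hT0, hTq⟩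
    by_cases hqW : q ∈ W
    · have hq : {q} ∈ F q := (hmemF q {q}).2 ⟨by simpa using hqW, by simp⟩
      rw [← Finset.add_sum_erase _ _ hq, Finset.prod_singleton, ha q, if_pos hqW]
      simp
    by_cases hq0 : q = 0
    · subst hq0
      have : F 0 = {∅} := by
        ext T
        rw [hmemF, Finset.mem_singleton]
        constructor
        · rintro ⟨hT, hT0⟩
          by_contra hne
          refine zero_notMem_posIdx ?_
          rw [← hT0]
          exact sum_mem_posIdx (Finset.nonempty_iff_ne_empty.2 hne) fun p hp => (hT hp).2
        · rintro rfl
          simp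
      rw [this, h0]
      simp
    · have hqC : q ∉ C := fun h => hqW (hCW q h hq0)
      have : F q = ∅ := Finset.eq_empty_of_forall_notMem fun T hT => by
        obtain ⟨hTW, rfl⟩ := (hmemF q T).1 hT
        exact hqC (hCsum T (hTW.trans Set.inter_subset_left))
      rw [this, Finset.sum_empty]
      by_contra hx
      refine hqC (AddSubmonoid.subset_closure ?_)
      change cf q (x - 1) ≠ 0
      rw [map_sub, cf_one, if_neg hq0, sub_zero]
      exact Ne.symm hx

end Convergence

/-! ### Lowest terms of products over positive indices. -/

section PositiveProducts

variable {R : Type*} [CommRing R] {a : ℤ × ℤ → R} {x : DoubleLaurent R}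

theorem cf_prod_of_mem_negIdx {S : Finset (ℤ × ℤ)} (hS : (S : Set (ℤ × ℤ)) ⊆ posIdx)
    {q : ℤ × ℤ} (hq : q ∈ negIdx) : cf q (∏ p ∈ S, (1 - mono p.1 p.2 (a p))) = 0 := by
  rw [cf_prod_eq_sum (F := ∅) (by simp), Finset.sum_empty]
  rintro T hT - rfl
  exfalso
  rcases T.eq_empty_or_nonempty with rfl | hne
  · exact zero_notMem_negIdx hq
  · exact notMem_posIdx_of_mem_negIdx hq (sum_mem_posIdx hne fun p hp => hS (hT hp))

theorem cf_zero_prod {S : Finset (ℤ × ℤ)} (hS : (S : Set (ℤ × ℤ)) ⊆ posIdx) :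
    cf 0 (∏ p ∈ S, (1 - mono p.1 p.2 (a p))) = 1 := by
  rw [cf_prod_eq_sum (F := {∅}) (by simp)]
  · simp
  · rintro T hT - hT0
    rw [Finset.mem_singleton]
    by_contra hne
    refine zero_notMem_posIdx ?_
    rw [← hT0]
    exact sum_mem_posIdx (Finset.nonempty_iff_ne_empty.2 hne) fun p hp => hS (hT hp)

theorem HasInfiniteProduct.cf_of_mem_negIdx (h : HasInfiniteProduct posIdx a x) {q : ℤ × ℤ}
    (hq : q ∈ negIdx) : cf q x = 0 := by
  obtain ⟨S, -, hS, h⟩ := h.exists_cf_eq q (A := ∅) (by simp)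
  rw [h, cf_prod_of_mem_negIdx hS hq]

theorem HasInfiniteProduct.cf_zero (h : HasInfiniteProduct posIdx a x) : cf 0 x = 1 := by
  obtain ⟨S, -, hS, h⟩ := h.exists_cf_eq 0 (A := ∅) (by simp)
  rw [h, cf_zero_prod hS]

end PositiveProducts

/-! ### When the factors T, S, Q are trivial. -/

section Factors

variable {R : Type*} [CommRing R]

theorem toUnit_one : toUnit (1 : R) = 1 := by
  rw [toUnit, dif_pos isUnit_one]
  exact Units.ext rfl

theorem coe_toUnit {x : R} (hx : IsUnit x) : (toUnit x : R) = x := by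
  rw [toUnit, dif_pos hx]
  rfl

/-- A factor `T` is trivial unless a positive combination of its indices vanishes. -/
theorem exists_of_factorT_ne_one {p q r : ℤ × ℤ} {a b c : R} (h : factorT p q r a b c ≠ 1) :
    ∃ α β γ : ℕ, 0 < α ∧ 0 < β ∧ 0 < γ ∧ α • p + β • q + γ • r = 0 ∧
      a ^ α * b ^ β * c ^ γ ≠ 0 := by
  unfold factorT at h
  extract_lets p₀ q₀ r₀ d x at h
  have hsign : (0 < p₀ ∧ 0 < q₀ ∧ 0 < r₀) ∨ (p₀ < 0 ∧ q₀ < 0 ∧ r₀ < 0) := by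
    by_contra hs
    rw [not_or] at hs
    exact h (by rw [if_neg hs.1, if_neg hs.2])
  have hx : a ^ (p₀.natAbs / d) * b ^ (q₀.natAbs / d) * c ^ (r₀.natAbs / d) ≠ 0 := by
    intro h0
    have : x = 1 := by
      change toUnit _ = 1
      rw [h0, sub_zero, toUnit_one]
    exact h (by simp [this])
  have hp0 : 0 < p₀.natAbs := by omega
  have hq0 : 0 < q₀.natAbs := by omega
  have hr0 : 0 < r₀.natAbs := by omega
  have hd : 0 < d := Nat.gcd_pos_of_pos_left _ hp0
  have hdp : d ∣ p₀.natAbs := Nat.gcd_dvd_left _ _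
  have hdq : d ∣ q₀.natAbs := (Nat.gcd_dvd_right _ _).trans (Nat.gcd_dvd_left _ _)
  have hdr : d ∣ r₀.natAbs := (Nat.gcd_dvd_right _ _).trans (Nat.gcd_dvd_right _ _)
  refine ⟨_, _, _, Nat.div_pos (Nat.le_of_dvd hp0 hdp) hd, Nat.div_pos (Nat.le_of_dvd hq0 hdq) hd,
    Nat.div_pos (Nat.le_of_dvd hr0 hdr) hd, ?_, hx⟩
  -- Three vectors in the plane satisfy the relation whose weights are their 2 × 2 determinants;
  -- with a common sign, dividing by the signed gcd makes the weights positive.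
  have h1 : p₀ * p.1 + q₀ * q.1 + r₀ * r.1 = 0 := by simp only [p₀, q₀, r₀, det]; ring
  have h2 : p₀ * p.2 + q₀ * q.2 + r₀ * r.2 = 0 := by simp only [p₀, q₀, r₀, det]; ring
  have key : ∀ u v w : ℤ, p₀ * u + q₀ * v + r₀ * w = 0 →
      ((p₀.natAbs / d : ℕ) : ℤ) * u + ((q₀.natAbs / d : ℕ) : ℤ) * v +
        ((r₀.natAbs / d : ℕ) : ℤ) * w = 0 := by
    intro u v w huvw
    have hd' : (d : ℤ) ≠ 0 := by exact_mod_cast hd.ne'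
    have e1 : (d : ℤ) * ((p₀.natAbs / d : ℕ) : ℤ) = |p₀| := by
      rw [← Nat.cast_mul, Nat.mul_div_cancel' hdp, Int.natCast_natAbs]
    have e2 : (d : ℤ) * ((q₀.natAbs / d : ℕ) : ℤ) = |q₀| := by
      rw [← Nat.cast_mul, Nat.mul_div_cancel' hdq, Int.natCast_natAbs]
    have e3 : (d : ℤ) * ((r₀.natAbs / d : ℕ) : ℤ) = |r₀| := by
      rw [← Nat.cast_mul, Nat.mul_div_cancel' hdr, Int.natCast_natAbs]
    apply mul_left_cancel₀ hd'
    rw [mul_zero, mul_add, mul_add, ← mul_assoc, ← mul_assoc, ← mul_assoc, e1, e2, e3]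
    rcases hsign with ⟨s1, s2, s3⟩ | ⟨s1, s2, s3⟩
    · rw [abs_of_pos s1, abs_of_pos s2, abs_of_pos s3, huvw]
    · rw [abs_of_neg s1, abs_of_neg s2, abs_of_neg s3]
      linarith
  refine Prod.ext ?_ ?_
  · simpa using key _ _ _ h1
  · simpa using key _ _ _ h2

/-- The vectors (i, j) and (k, l) are collinear with negative inner product, so they point in
opposite directions. Indeed (jl)(ik) = (jk)² ≥ 0 rules out jl > 0. -/
theorem natAbs_div_gcd_combination {i j k l : ℤ} (hdet : j * k - l * i = 0)
    (hdot : j * l + i * k < 0) (hjl : j * l ≠ 0) :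
    0 < l.natAbs / Int.gcd j l ∧ 0 < j.natAbs / Int.gcd j l ∧
      ((l.natAbs / Int.gcd j l : ℕ) : ℤ) * i + ((j.natAbs / Int.gcd j l : ℕ) : ℤ) * k = 0 ∧
      ((l.natAbs / Int.gcd j l : ℕ) : ℤ) * j + ((j.natAbs / Int.gcd j l : ℕ) : ℤ) * l = 0 := by
  have hj : j ≠ 0 := left_ne_zero_of_mul hjl
  have hl : l ≠ 0 := right_ne_zero_of_mul hjl
  have hneg : j * l < 0 := by
    by_contra hpos
    have hpos : 0 < j * l := lt_of_le_of_ne (not_lt.1 hpos) hjl.symm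
    have hsq : (j * l) * (i * k) = (j * k) ^ 2 := by
      have : l * i = j * k := by linarith
      calc (j * l) * (i * k) = (j * k) * (l * i) := by ring
        _ = (j * k) ^ 2 := by rw [this]; ring
    nlinarith [sq_nonneg (j * k)]
  have hd : 0 < Int.gcd j l := Int.gcd_pos_of_ne_zero_left _ hj
  have hdj : Int.gcd j l ∣ j.natAbs := Nat.gcd_dvd_left _ _
  have hdl : Int.gcd j l ∣ l.natAbs := Nat.gcd_dvd_right _ _
  have e1 : (Int.gcd j l : ℤ) * ((l.natAbs / Int.gcd j l : ℕ) : ℤ) = |l| := by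
    rw [← Nat.cast_mul, Nat.mul_div_cancel' hdl, Int.natCast_natAbs]
  have e2 : (Int.gcd j l : ℤ) * ((j.natAbs / Int.gcd j l : ℕ) : ℤ) = |j| := by
    rw [← Nat.cast_mul, Nat.mul_div_cancel' hdj, Int.natCast_natAbs]
  have hd' : (Int.gcd j l : ℤ) ≠ 0 := by exact_mod_cast hd.ne'
  refine ⟨Nat.div_pos (Nat.le_of_dvd (Int.natAbs_pos.2 hl) hdl) hd,
    Nat.div_pos (Nat.le_of_dvd (Int.natAbs_pos.2 hj) hdj) hd, ?_, ?_⟩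
  all_goals
    apply mul_left_cancel₀ hd'
    rw [mul_zero, mul_add, ← mul_assoc, ← mul_assoc, e1, e2]
    rcases mul_neg_iff.1 hneg with ⟨s1, s2⟩ | ⟨s1, s2⟩
    · rw [abs_of_pos s1, abs_of_neg s2]
      linarith
    · rw [abs_of_neg s1, abs_of_pos s2]
      linarith

/-- A factor `S` is trivial unless a positive combination of its indices vanishes. -/
theorem exists_of_factorS_ne_one {p q : ℤ × ℤ} {a b : R} (h : factorS p q a b ≠ 1) :
    ∃ α β : ℕ, 0 < α ∧ 0 < β ∧ α • p + β • q = 0 ∧ a ^ α * b ^ β ≠ 0 := by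
  unfold factorS at h
  extract_lets d at h
  split_ifs at h with hpq
  swap
  · exact absurd rfl h
  obtain ⟨hα, hβ, h1, h2⟩ := natAbs_div_gcd_combination hpq.1 hpq.2.1 hpq.2.2
  refine ⟨_, _, hα, hβ, Prod.ext (by simpa using h1) (by simpa using h2), fun h0 => h ?_⟩
  rw [h0, sub_zero, toUnit_one, one_zpow]

/-- A factor `Q` is trivial unless a positive combination of its indices vanishes. -/
theorem exists_of_factorQ_ne_one {p q : ℤ × ℤ} {a b : R} (h : factorQ p q a b ≠ 1) :
    ∃ α β : ℕ, 0 < α ∧ 0 < β ∧ α • p + β • q = 0 ∧ a ^ α * b ^ β ≠ 0 := by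
  unfold factorQ at h
  extract_lets d at h
  split_ifs at h with hpq
  swap
  · exact absurd rfl h
  -- The case of S with the two coordinates exchanged.
  obtain ⟨hα, hβ, h1, h2⟩ := natAbs_div_gcd_combination (i := p.2) (j := p.1) (k := q.2)
    (l := q.1) (by linarith [hpq.1, show det p q = p.2 * q.1 - q.2 * p.1 from rfl])
    (by linarith [hpq.2.1]) hpq.2.2
  refine ⟨_, _, hα, hβ, Prod.ext (by simpa using h2) (by simpa using h1), fun h0 => h ?_⟩
  rw [h0, sub_zero, toUnit_one, one_zpow]

theorem nsmul_mem_posIdx {p : ℤ × ℤ} (hp : p ∈ posIdx) {α : ℕ} (hα : 0 < α) : α • p ∈ posIdx := by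
  rw [mem_posIdx_iff] at *
  exact nsmul_pos hp hα.ne'

variable {a b c : ℤ × ℤ → R}

theorem famT_eq_one (ha : ∀ p ∉ posIdx, a p = 0) (hb : ∀ p ∉ posIdx, b p = 0)
    (hc : ∀ p ∉ posIdx, c p = 0) : famT a b c = 1 := by
  funext x
  by_contra hx
  obtain ⟨α, β, γ, hα, hβ, hγ, h, h0⟩ := exists_of_factorT_ne_one hx
  have h1 : x.1 ∈ posIdx := by
    by_contra h'
    exact h0 (by rw [ha _ h', zero_pow hα.ne', zero_mul, zero_mul])
  have h2 : x.2.1 ∈ posIdx := by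
    by_contra h'
    exact h0 (by rw [hb _ h', zero_pow hβ.ne', mul_zero, zero_mul])
  have h3 : x.2.2 ∈ posIdx := by
    by_contra h'
    exact h0 (by rw [hc _ h', zero_pow hγ.ne', mul_zero])
  refine zero_notMem_posIdx ?_
  rw [← h]
  exact add_mem_posIdx (add_mem_posIdx (nsmul_mem_posIdx h1 hα) (nsmul_mem_posIdx h2 hβ))
    (nsmul_mem_posIdx h3 hγ)

theorem pow_mul_pow_eq_zero_of_posIdx (ha : ∀ p ∉ posIdx, a p = 0) (hb : ∀ p ∉ posIdx, b p = 0)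
    {p q : ℤ × ℤ} {α β : ℕ} (hα : 0 < α) (hβ : 0 < β) (h : α • p + β • q = 0) :
    a p ^ α * b q ^ β = 0 := by
  by_contra h0
  have h1 : p ∈ posIdx := by
    by_contra h'
    exact h0 (by rw [ha _ h', zero_pow hα.ne', zero_mul])
  have h2 : q ∈ posIdx := by
    by_contra h'
    exact h0 (by rw [hb _ h', zero_pow hβ.ne', mul_zero])
  refine zero_notMem_posIdx ?_
  rw [← h]
  exact add_mem_posIdx (nsmul_mem_posIdx h1 hα) (nsmul_mem_posIdx h2 hβ)

theorem famS_eq_one (ha : ∀ p ∉ posIdx, a p = 0) (hb : ∀ p ∉ posIdx, b p = 0) :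
    famS a b = 1 := by
  funext x
  by_contra hx
  obtain ⟨α, β, hα, hβ, h, h0⟩ := exists_of_factorS_ne_one hx
  exact h0 (pow_mul_pow_eq_zero_of_posIdx ha hb hα hβ h)

theorem famQ_eq_one (ha : ∀ p ∉ posIdx, a p = 0) (hb : ∀ p ∉ posIdx, b p = 0) :
    famQ a b = 1 := by
  funext x
  by_contra hx
  obtain ⟨α, β, hα, hβ, h, h0⟩ := exists_of_factorQ_ne_one hx
  exact h0 (pow_mul_pow_eq_zero_of_posIdx ha hb hα hβ h)

end Factors

/-! ### The symbol over a field and the tame symbol. -/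

section Field

theorem order_eq_of_coeff {A : Type*} [CommRing A] {x : LaurentSeries A} {n : ℤ} (h : x.coeff n ≠ 0)
    (h' : ∀ i < n, x.coeff i = 0) : x.order = n := by
  refine le_antisymm (HahnSeries.order_le_of_coeff_ne_zero h) (not_lt.1 fun hlt => ?_)
  have hx : x ≠ 0 := fun h0 => h (by simp [h0])
  exact hx (HahnSeries.coeff_order_eq_zero.1 (h' _ hlt))

/-- The order as a homomorphism. -/
noncomputable def orderHom (A : Type*) [CommRing A] [IsDomain A] :
    (LaurentSeries A)ˣ →* Multiplicative ℤ where
  toFun x := Multiplicative.ofAdd (x : LaurentSeries A).order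
  map_one' := by simp
  map_mul' x y := by
    rw [Units.val_mul, HahnSeries.order_mul x.ne_zero y.ne_zero, ofAdd_add]

/-- The leading coefficient as a homomorphism. -/
noncomputable def leadHom (A : Type*) [CommRing A] [IsDomain A] : (LaurentSeries A)ˣ →* Aˣ :=
  Units.map
    { toFun := fun x => x.leadingCoeff
      map_one' := HahnSeries.leadingCoeff_one
      map_mul' := fun x y => HahnSeries.leadingCoeff_mul x y }

variable {k : Type*} [Field k]

/-- The leading coefficient of the leading coefficient. -/
noncomputable def leadHom₂ (k : Type*) [Field k] : (DoubleLaurent k)ˣ →* kˣ :=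
  (leadHom k).comp (leadHom (LaurentSeries k))

theorem coe_leadHom₂ (x : (DoubleLaurent k)ˣ) :
    (leadHom₂ k x : k) = (x : DoubleLaurent k).leadingCoeff.leadingCoeff := rfl

theorem fst_val (x : (DoubleLaurent k)ˣ) :
    (val (x : DoubleLaurent k)).1 = (orderHom _ x).toAdd := rfl

theorem snd_val (x : (DoubleLaurent k)ˣ) :
    (val (x : DoubleLaurent k)).2 = (orderHom _ (leadHom _ x)).toAdd := rfl

/-- The rank two valuation is the lexicographically least index of the support. -/
theorem val_eq_and_leadingCoeff_eq {x : DoubleLaurent k} {ν : ℤ × ℤ} (h : cf ν x ≠ 0)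
    (h' : ∀ q, q - ν ∈ negIdx → cf q x = 0) :
    val x = ν ∧ x.leadingCoeff.leadingCoeff = cf ν x := by
  have h1 : x.order = ν.1 := by
    refine order_eq_of_coeff (fun h0 => h (by simp [cf_apply, h0])) fun i hi => ?_
    ext j
    exact h' (i, j) (Or.inl (by simpa using hi))
  have h2 : x.leadingCoeff = x.coeff ν.1 := by rw [HahnSeries.leadingCoeff_eq, h1]
  have h3 : x.leadingCoeff.order = ν.2 := by
    rw [h2]
    exact order_eq_of_coeff h fun j hj => h' (ν.1, j) (Or.inr ⟨by simp, by simpa using hj⟩)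
  refine ⟨Prod.ext h1 h3, ?_⟩
  rw [HahnSeries.leadingCoeff_eq, h3, h2]
  rfl

theorem cf_val (x : DoubleLaurent k) : cf (val x) x = x.leadingCoeff.leadingCoeff := by
  rw [HahnSeries.leadingCoeff_eq (x := x.leadingCoeff)]
  change (x.coeff x.order).coeff _ = _
  rw [← HahnSeries.leadingCoeff_eq]
  rfl

theorem cf_of_sub_val_mem_negIdx {x : DoubleLaurent k} {q : ℤ × ℤ} (h : q - val x ∈ negIdx) :
    cf q x = 0 := by
  rcases h with h | ⟨h1, h2⟩
  · rw [cf_apply, HahnSeries.coeff_eq_zero_of_lt_order (sub_neg.1 h), HahnSeries.coeff_zero]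
  · have : x.coeff q.1 = x.leadingCoeff := by
      rw [sub_eq_zero.1 h1, HahnSeries.leadingCoeff_eq]
      rfl
    rw [cf_apply, this]
    exact HahnSeries.coeff_eq_zero_of_lt_order (sub_neg.1 h2)

namespace Decomposition

theorem a_eq_zero {f : DoubleLaurent k} (F : Decomposition f) :
    ∀ p ∉ posIdx, F.a p = 0 := fun p hp => by
  rcases mem_negIdx_or_eq_zero_or_mem_posIdx p with h | rfl | h
  · exact (F.a_nilpotent p h).eq_zero
  · exact F.a_zero
  · exact absurd h hp

theorem neg_eq_one {f : DoubleLaurent k} (F : Decomposition f) : F.neg = 1 := by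
  refine ext_cf fun q => ?_
  obtain ⟨S, -, hS, h⟩ := F.neg_eq.exists_cf_eq q (A := ∅) (by simp)
  rw [h, Finset.prod_eq_one fun p hp => by
    rw [F.a_eq_zero p (fun h' => notMem_posIdx_of_mem_negIdx (hS hp) h'), mono_zero, sub_zero]]

theorem val_eq_ν {f : DoubleLaurent k} (F : Decomposition f) :
    val f = F.ν ∧ f.leadingCoeff.leadingCoeff = F.unit := by
  have hf : ∀ q, cf q f = F.unit * cf (q - F.ν) F.pos := fun q => by
    refine (congrArg (cf q) F.eq_mul).trans ?_
    rw [F.neg_eq_one, one_mul, cf_mono_mul]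
    rfl
  have h1 : cf F.ν f = F.unit := by rw [hf, sub_self, F.pos_eq.cf_zero, mul_one]
  rw [← h1]
  refine val_eq_and_leadingCoeff_eq (h1 ▸ F.unit.ne_zero) fun q hq => ?_
  rw [hf, F.pos_eq.cf_of_mem_negIdx hq, mul_zero]

/-- Divide by the lowest monomial; what remains has constant term 1 and no negative terms, so it is
a positive product, and the negative factor can be taken to be 1. -/
theorem nonempty_of_field (f : (DoubleLaurent k)ˣ) :
    Nonempty (Decomposition (f : DoubleLaurent k)) := by
  classical
  set ν := val (f : DoubleLaurent k) with hν
  set c : kˣ := leadHom₂ k f with hc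
  have hx : ∀ q, cf q (mono (-ν.1) (-ν.2) (c⁻¹ : kˣ).val * (f : DoubleLaurent k)) =
      (c⁻¹ : kˣ).val * cf (q + ν) (f : DoubleLaurent k) :=
    fun q => by
      rw [cf_mono_mul, show q - (-ν.1, -ν.2) = q + ν from sub_neg_eq_add q ν]
  obtain ⟨a, ha⟩ := exists_hasInfiniteProduct_posIdx
    (mono (-ν.1) (-ν.2) (c⁻¹ : kˣ).val * (f : DoubleLaurent k))
    (by rw [hx, zero_add, hν, cf_val, ← coe_leadHom₂, ← hc, Units.inv_mul])
    (fun q hq => by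
      rw [hx, cf_of_sub_val_mem_negIdx (by rwa [← hν, add_sub_cancel_right]), mul_zero])
  exact ⟨{
    ν₁ := ν.1
    ν₂ := ν.2
    unit := c
    a := fun p => if p ∈ posIdx then a p else 0
    neg := 1
    pos := mono (-ν.1) (-ν.2) (c⁻¹ : kˣ).val * (f : DoubleLaurent k)
    a_zero := if_neg zero_notMem_posIdx
    a_nilpotent := fun p hp => by
      rw [if_neg (notMem_posIdx_of_mem_negIdx hp)]
      exact IsNilpotent.zero
    a_bounded := ⟨0, 0, fun p hp h => absurd (if_neg (notMem_posIdx_of_mem_negIdx hp)) h⟩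
    neg_eq := hasInfiniteProduct_one fun p hp => if_neg (notMem_posIdx_of_mem_negIdx hp)
    pos_eq := ha.congr fun p hp => (if_pos hp).symm
    eq_mul := by
      rw [one_mul, ← mul_assoc, mono_mul_mono, Units.mul_inv, add_neg_cancel, add_neg_cancel,
        ← one_eq_mono, one_mul] }⟩

theorem finiteFactors_of_field {f g h : DoubleLaurent k} (F : Decomposition f)
    (G : Decomposition g) (H : Decomposition h) : F.FiniteFactors G H := by
  simp only [FiniteFactors, famT_eq_one F.a_eq_zero G.a_eq_zero H.a_eq_zero,
    famS_eq_one F.a_eq_zero G.a_eq_zero, famQ_eq_one F.a_eq_zero G.a_eq_zero,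
    famS_eq_one H.a_eq_zero F.a_eq_zero, famQ_eq_one H.a_eq_zero F.a_eq_zero,
    famS_eq_one G.a_eq_zero H.a_eq_zero, famQ_eq_one G.a_eq_zero H.a_eq_zero]
  simp

theorem symbol_of_field {f g h : DoubleLaurent k} (F : Decomposition f)
    (G : Decomposition g) (H : Decomposition h) : F.symbol G H =
      (-1) ^ signExp F.ν G.ν H.ν *
        (F.unit ^ det G.ν H.ν * G.unit ^ det H.ν F.ν * H.unit ^ det F.ν G.ν) := by
  simp [symbol, famT_eq_one F.a_eq_zero G.a_eq_zero H.a_eq_zero,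
    famS_eq_one F.a_eq_zero G.a_eq_zero, famQ_eq_one F.a_eq_zero G.a_eq_zero,
    famS_eq_one H.a_eq_zero F.a_eq_zero, famQ_eq_one H.a_eq_zero F.a_eq_zero,
    famS_eq_one G.a_eq_zero H.a_eq_zero, famQ_eq_one G.a_eq_zero H.a_eq_zero]

end Decomposition

theorem tameSymbol_eq (f g h : (DoubleLaurent k)ˣ) :
    tameSymbol f g h = (((-1) ^ signExp (val (f : DoubleLaurent k)) (val (g : DoubleLaurent k))
      (val (h : DoubleLaurent k)) *
      (leadHom₂ k f ^ det (val (g : DoubleLaurent k)) (val (h : DoubleLaurent k)) *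
        leadHom₂ k g ^ det (val (h : DoubleLaurent k)) (val (f : DoubleLaurent k)) *
        leadHom₂ k h ^ det (val (f : DoubleLaurent k)) (val (g : DoubleLaurent k))) : kˣ) : k) := by
  unfold tameSymbol
  extract_lets vf vg vh w
  -- The exponents of f, g, h are the weights of the linear relation between the three valuation
  -- vectors.
  have hv : val (w : DoubleLaurent k) = 0 := by
    refine Prod.ext ?_ ?_
    · rw [fst_val]
      simp only [w, map_mul, map_zpow, toAdd_mul, toAdd_zpow, ← fst_val, smul_eq_mul]
      simp only [vf, vg, vh, det, Prod.fst_zero]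
      ring
    · rw [snd_val]
      simp only [w, map_mul, map_zpow, toAdd_mul, toAdd_zpow, ← snd_val, smul_eq_mul]
      simp only [vf, vg, vh, det, Prod.snd_zero]
      ring
  have hw : ((w : DoubleLaurent k).coeff 0).coeff 0 = (leadHom₂ k w : k) := by
    rw [coe_leadHom₂, ← cf_val, hv]
    rfl
  rw [hw, ← Units.val_mul]
  simp only [w, map_mul, map_zpow]
  rfl

theorem isSymbolValue_field_iff {f g h : (DoubleLaurent k)ˣ} {c : kˣ} :
    IsSymbolValue f g h c ↔ (c : k) = tameSymbol f g h := by
  have key : ∀ (F : Decomposition (f : DoubleLaurent k)) (G : Decomposition (g : DoubleLaurent k))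
      (H : Decomposition (h : DoubleLaurent k)), ((F.symbol G H : kˣ) : k) = tameSymbol f g h := by
    intro F G H
    have hF : F.unit = leadHom₂ k f := Units.ext F.val_eq_ν.2.symm
    have hG : G.unit = leadHom₂ k g := Units.ext G.val_eq_ν.2.symm
    have hH : H.unit = leadHom₂ k h := Units.ext H.val_eq_ν.2.symm
    rw [tameSymbol_eq, F.symbol_of_field, F.val_eq_ν.1, G.val_eq_ν.1, H.val_eq_ν.1, hF, hG, hH]
  constructor
  · rintro ⟨F, G, H, -, rfl⟩
    exact key F G H
  · intro hc
    obtain ⟨F⟩ := Decomposition.nonempty_of_field f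
    obtain ⟨G⟩ := Decomposition.nonempty_of_field g
    obtain ⟨H⟩ := Decomposition.nonempty_of_field h
    exact ⟨F, G, H, F.finiteFactors_of_field G H, Units.ext (hc.trans (key F G H).symm)⟩

end Field

theorem existsUnique_and_symbol_eq {R : Type*} [CommRing R] {f g h : (DoubleLaurent R)ˣ} {s : R}
    (hs : IsUnit s) (H : ∀ c, IsSymbolValue f g h c ↔ (c : R) = s) :
    (∃! c : Rˣ, IsSymbolValue f g h c) ∧ (symbol f g h : R) = s :=
  ⟨⟨hs.unit, (H _).2 rfl, fun _ hc => Units.ext ((H _).1 hc)⟩,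
    (H _).1 (Classical.epsilon_spec ⟨hs.unit, (H _).2 rfl⟩)⟩

/-! ### Infinite products modulo powers of an ideal. -/

section Congruences

variable {R : Type*} [CommRing R] {I : Ideal R} {s : Set (ℤ × ℤ)} {a b : ℤ × ℤ → R}
  {x y : DoubleLaurent R}

theorem coeffIdeal_mono {I J : Ideal R} (h : I ≤ J) : coeffIdeal I ≤ coeffIdeal J :=
  fun _ hx q => h (hx q)

theorem mono_mem_coeffIdeal {r : R} (hr : r ∈ I) (i j : ℤ) : mono i j r ∈ coeffIdeal I := by
  intro q
  rw [cf_mono]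
  split_ifs
  · exact hr
  · exact I.zero_mem

theorem prod_one_sub_sub_one_mem (S : Finset (ℤ × ℤ)) (h : ∀ p ∈ S, a p ∈ I) :
    ∏ p ∈ S, (1 - mono p.1 p.2 (a p)) - 1 ∈ coeffIdeal I := by
  induction S using Finset.cons_induction with
  | empty => simp
  | cons p S hp ih =>
    rw [Finset.prod_cons]
    have h1 := ih fun q hq => h q (by simp [hq])
    have h2 := mono_mem_coeffIdeal (h p (by simp)) p.1 p.2
    have : (1 - mono p.1 p.2 (a p)) * ∏ q ∈ S, (1 - mono q.1 q.2 (a q)) - 1 =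
      (∏ q ∈ S, (1 - mono q.1 q.2 (a q)) - 1) -
        (∏ q ∈ S, (1 - mono q.1 q.2 (a q))) * mono p.1 p.2 (a p) := by ring
    rw [this]
    exact sub_mem h1 (Ideal.mul_mem_left _ _ h2)

theorem HasInfiniteProduct.sub_one_mem (h : HasInfiniteProduct s a x) (ha : ∀ p ∈ s, a p ∈ I) :
    x - 1 ∈ coeffIdeal I := by
  intro q
  obtain ⟨S, -, hS, h⟩ := h.exists_cf_eq q (A := ∅) (by simp)
  rw [map_sub, h, ← map_sub]
  exact prod_one_sub_sub_one_mem S (fun p hp => ha p (hS hp)) q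

/-- Each term of the expansion involving some b p and anything beyond it has an additional factor in
I, so only the linear terms in b survive modulo the next power. -/
theorem prod_one_sub_add_sub_mem {n : ℕ} (hn : 1 ≤ n) (S : Finset (ℤ × ℤ))
    (ha : ∀ p ∈ S, a p ∈ I) (hb : ∀ p ∈ S, b p ∈ I ^ n) :
    ∏ p ∈ S, (1 - mono p.1 p.2 (a p + b p)) - ∏ p ∈ S, (1 - mono p.1 p.2 (a p)) +
      ∑ p ∈ S, mono p.1 p.2 (b p) ∈ coeffIdeal (I ^ (n + 1)) := by
  induction S using Finset.cons_induction with
  | empty => simp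
  | cons p S hp ih =>
    rw [Finset.prod_cons, Finset.prod_cons, Finset.sum_cons]
    have h1 := ih (fun q hq => ha q (by simp [hq])) fun q hq => hb q (by simp [hq])
    have hap := mono_mem_coeffIdeal (ha p (by simp)) p.1 p.2
    have hbp := mono_mem_coeffIdeal (hb p (by simp)) p.1 p.2
    have hB : ∑ q ∈ S, mono q.1 q.2 (b q) ∈ coeffIdeal (I ^ n) :=
      sum_mem fun q hq => mono_mem_coeffIdeal (hb q (by simp [hq])) q.1 q.2
    have hA : ∏ q ∈ S, (1 - mono q.1 q.2 (a q + b q)) - 1 ∈ coeffIdeal I :=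
      prod_one_sub_sub_one_mem S fun q hq => add_mem (ha q (by simp [hq]))
        (Ideal.pow_le_self (by omega) (hb q (by simp [hq])))
    have hadd : mono p.1 p.2 (a p + b p) = mono p.1 p.2 (a p) + mono p.1 p.2 (b p) := by
      simp [mono]
    rw [hadd]
    generalize mono p.1 p.2 (a p) = α at *
    generalize mono p.1 p.2 (b p) = β at *
    generalize ∏ q ∈ S, (1 - mono q.1 q.2 (a q + b q)) = A at *
    generalize ∏ q ∈ S, (1 - mono q.1 q.2 (a q)) = A' at *
    generalize ∑ q ∈ S, mono q.1 q.2 (b q) = B at *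
    have : (1 - (α + β)) * A - (1 - α) * A' + (β + B) =
        (1 - α) * (A - A' + B) + α * B - β * (A - 1) := by ring
    rw [this]
    refine sub_mem (add_mem (Ideal.mul_mem_left _ _ h1) ?_) ?_
    · exact mul_mem_coeffIdeal (pow_succ' I n).ge hap hB
    · exact mul_mem_coeffIdeal (pow_succ I n).ge hbp hA

theorem cf_sum_mono {S : Finset (ℤ × ℤ)} {q : ℤ × ℤ} (hq : q ∈ s → q ∈ S)
    (hS : (S : Set (ℤ × ℤ)) ⊆ s) [Decidable (q ∈ s)] :
    cf q (∑ p ∈ S, mono p.1 p.2 (b p)) = if q ∈ s then b q else 0 := by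
  simp only [map_sum, cf_mono]
  rw [Finset.sum_ite_eq S q b]
  by_cases h : q ∈ s
  · rw [if_pos h, if_pos (hq h)]
  · rw [if_neg h, if_neg fun h' : q ∈ S => h (hS h')]

open Classical in
/-- Infinite products, to first order in a perturbation of the coefficients. -/
theorem HasInfiniteProduct.cf_sub_add_mem {n : ℕ} (hn : 1 ≤ n) (ha : ∀ p ∈ s, a p ∈ I)
    (hb : ∀ p ∈ s, b p ∈ I ^ n) (hx : HasInfiniteProduct s a x)
    (hy : HasInfiniteProduct s (fun p => a p + b p) y) (q : ℤ × ℤ) :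
    cf q y - cf q x + (if q ∈ s then b q else 0) ∈ I ^ (n + 1) := by
  obtain ⟨S₁, hS₁, h₁⟩ := hx.exists_forall_cf_eq q
  obtain ⟨S₂, hS₂, h₂⟩ := hy.exists_forall_cf_eq q
  -- The index q is included so that the linear sum contains its term at q.
  set S : Finset (ℤ × ℤ) := S₁ ∪ S₂ ∪ (if q ∈ s then {q} else ∅) with hSdef
  have hS : (S : Set (ℤ × ℤ)) ⊆ s := by
    rw [hSdef, Finset.coe_union, Finset.coe_union]
    refine Set.union_subset (Set.union_subset hS₁ hS₂) ?_
    split_ifs with h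
    · simpa using h
    · simp
  have hq : q ∈ s → q ∈ S := fun h => by simp [hSdef, h]
  have h₁' := h₁ S (fun p hp => by simp [hSdef, hp]) hS
  have h₂' := h₂ S (fun p hp => by simp [hSdef, hp]) hS
  rw [h₁', h₂', ← cf_sum_mono hq hS, ← map_sub, ← map_add]
  exact prod_one_sub_add_sub_mem hn S (fun p hp => ha p (hS hp)) (fun p hp => hb p (hS hp)) q

open Classical in
theorem HasInfiniteProduct.cf_sub_one_add_mem (ha : ∀ p ∈ s, a p ∈ I)
    (hx : HasInfiniteProduct s a x) (q : ℤ × ℤ) :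
    cf q (x - 1) + (if q ∈ s then a q else 0) ∈ I ^ 2 := by
  rw [map_sub]
  refine HasInfiniteProduct.cf_sub_add_mem (n := 1) (a := fun _ => 0) le_rfl
    (fun _ _ => I.zero_mem) (fun p hp => by rw [pow_one]; exact ha p hp)
    (hasInfiniteProduct_one fun _ _ => rfl) (hx.congr fun p _ => (zero_add _).symm) q

/-- The coefficient at q is -a q plus terms from the other subsets with sum q; each of these terms
lies in I by hypothesis. -/
theorem mem_of_forall_prod_mem (h : HasInfiniteProduct posIdx a x) (hx : x - 1 ∈ coeffIdeal I)
    {q : ℤ × ℤ} (hq : q ∈ posIdx)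
    (hT : ∀ T : Finset (ℤ × ℤ), (∀ p ∈ T, p ∈ posIdx) → ∑ p ∈ T, p = q → T ≠ {q} →
      ∃ p ∈ T, a p ∈ I) : a q ∈ I := by
  classical
  obtain ⟨S, hqS, hS, h⟩ := h.exists_cf_eq q (A := {q}) (by simpa using hq)
  have hq0 : q ≠ 0 := fun h0 => zero_notMem_posIdx (h0 ▸ hq)
  have h1 := hx q
  rw [map_sub, cf_one, if_neg hq0, sub_zero, h, cf_prod_one_sub] at h1
  have hmem : {q} ∈ S.powerset.filter fun T => ∑ p ∈ T, p = q := by simpa using hqS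
  rw [← Finset.add_sum_erase _ _ hmem] at h1
  have h2 := (I.add_mem_iff_left (sum_mem fun T hT' => ?_)).1 h1
  · simpa using h2
  · simp only [Finset.mem_erase, Finset.mem_filter, Finset.mem_powerset] at hT'
    obtain ⟨p, hp, hpI⟩ := hT T (fun p hp => hS (hT'.2.1 hp)) hT'.2.2 hT'.1
    refine I.mul_mem_left _ ?_
    rw [← Finset.mul_prod_erase _ _ hp]
    exact I.mul_mem_right _ hpI

/-- A product over the positive indices that is congruent to `1` has all its coefficients congruent
to `0`. -/
theorem HasInfiniteProduct.coeff_mem (h : HasInfiniteProduct posIdx a x)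
    (hx : x - 1 ∈ coeffIdeal I) : ∀ q ∈ posIdx, a q ∈ I := by
  have hne : ∀ T : Finset (ℤ × ℤ), ∀ q ∈ posIdx, ∑ p ∈ T, p = q → T.Nonempty := by
    rintro T q hq hT
    by_contra he
    rw [Finset.not_nonempty_iff_eq_empty.1 he, Finset.sum_empty] at hT
    exact zero_notMem_posIdx (hT ▸ hq)
  -- The positive indices are not well ordered, since j is unbounded below in rows i > 0. So the
  -- induction runs over j in row 0 and then over i alone.
  have h0 : ∀ n : ℕ, ∀ q ∈ posIdx, q.1 = 0 → q.2.toNat = n → a q ∈ I := by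
    intro n
    induction n using Nat.strong_induction_on with
    | _ n ih =>
      intro q hq hq1 hqn
      refine mem_of_forall_prod_mem h hx hq fun T hT hTq hTne => ?_
      obtain ⟨p, hp⟩ := hne T q hq hTq
      have h1 := sum_sub_mem_posIdx hT hp (by rwa [hTq])
      have h2 := hT p hp
      rw [hTq] at h1
      refine ⟨p, hp, ih p.2.toNat ?_ p h2 ?_ rfl⟩
      all_goals
        simp only [posIdx, Set.mem_ofPred_eq, Prod.fst_sub, Prod.snd_sub] at h1 h2 hq
        omega
  have h1 : ∀ n : ℕ, ∀ q ∈ posIdx, q.1.toNat = n → a q ∈ I := by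
    intro n
    induction n using Nat.strong_induction_on with
    | _ n ih =>
      intro q hq hqn
      by_cases hq1 : q.1 = 0
      · exact h0 _ q hq hq1 rfl
      have hqpos : 0 < q.1 := by
        rcases hq with h | h
        · exact h
        · exact absurd h.1 hq1
      refine mem_of_forall_prod_mem h hx hq fun T hT hTq hTne => ?_
      -- Otherwise at least two elements of T have first coordinate ≥ q.1 > 0, and the total would
      -- be too large. One coefficient in I suffices, so other elements of T may stay in row q.1.
      obtain ⟨p, hp, hpq⟩ : ∃ p ∈ T, p.1 < q.1 := by
        by_contra hcon
        push Not at hcon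
        have hcard : 2 ≤ T.card := by
          have := (hne T q hq hTq).card_pos
          by_contra hlt
          obtain ⟨p, rfl⟩ := Finset.card_eq_one.1 (show T.card = 1 by omega)
          exact hTne (by rw [← hTq, Finset.sum_singleton])
        have hle := Finset.card_nsmul_le_sum T (fun p => p.1) q.1 hcon
        rw [← Prod.fst_sum, hTq, nsmul_eq_mul] at hle
        have : (2 : ℤ) ≤ T.card := by exact_mod_cast hcard
        nlinarith
      refine ⟨p, hp, ih p.1.toNat ?_ p (hT p hp) rfl⟩
      omega
  exact fun q hq => h1 _ q hq rfl

end Congruences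

/-! ### Decompositions of series congruent to 1. -/

namespace Decomposition

variable {R : Type*} [CommRing R] {I : Ideal R} {y : DoubleLaurent R}

/-- The decomposition of a series that is congruent to `1` modulo an ideal containing the
nilradical. -/
theorem of_sub_one_mem (F : Decomposition y) (hI : I ≠ ⊤)
    (hnil : ∀ x : R, IsNilpotent x → x ∈ I) (hy : y - 1 ∈ coeffIdeal I) :
    F.ν = 0 ∧ (∀ p, F.a p ∈ I) ∧ ∀ p, p ≠ 0 → cf p y + F.a p ∈ I ^ 2 := by
  classical
  have haneg : ∀ p ∈ negIdx, F.a p ∈ I := fun p hp => hnil _ (F.a_nilpotent p hp)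
  have hN := F.neg_eq.sub_one_mem haneg
  have hyeq : y = F.neg * (mono F.ν.1 F.ν.2 (F.unit : R) * F.pos) := by
    rw [← mul_assoc]
    exact F.eq_mul
  have hMP : mono F.ν.1 F.ν.2 (F.unit : R) * F.pos - 1 ∈ coeffIdeal I := by
    have : mono F.ν.1 F.ν.2 (F.unit : R) * F.pos - 1 =
        (F.neg * (mono F.ν.1 F.ν.2 (F.unit : R) * F.pos) - 1) -
          (mono F.ν.1 F.ν.2 (F.unit : R) * F.pos) * (F.neg - 1) := by ring
    rw [this, ← hyeq]
    exact sub_mem hy (Ideal.mul_mem_left _ _ hN)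
  have hcf : ∀ q, (F.unit : R) * cf (q - F.ν) F.pos - cf q (1 : DoubleLaurent R) ∈ I := fun q => by
    have := hMP q
    rwa [map_sub, cf_mono_mul] at this
  -- Modulo I the negative factor is 1, so the coefficient at ν is the unit; if ν ≠ 0 it would have
  -- to lie in I.
  have hν : F.ν = 0 := by
    by_contra hν
    have := hcf F.ν
    rw [sub_self, F.pos_eq.cf_zero, cf_one, if_neg hν, sub_zero, mul_one] at this
    exact hI (Ideal.eq_top_of_isUnit_mem _ this F.unit.isUnit)
  rw [hν] at hcf hMP hyeq
  have hunit : (F.unit : R) - 1 ∈ I := by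
    have := hcf 0
    rwa [sub_zero, F.pos_eq.cf_zero, cf_one, if_pos rfl, mul_one] at this
  have hP : F.pos - 1 ∈ coeffIdeal I := fun q => by
    have h1 := hcf q
    rw [sub_zero] at h1
    have h2 := sub_mem h1 (I.mul_mem_right (cf q (1 : DoubleLaurent R)) hunit)
    rw [← Ideal.unit_mul_mem_iff_mem I F.unit.isUnit, map_sub]
    convert h2 using 1
    ring
  have hapos := F.pos_eq.coeff_mem hP
  have ha : ∀ p, F.a p ∈ I := fun p => by
    rcases mem_negIdx_or_eq_zero_or_mem_posIdx p with h | rfl | h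
    · exact haneg p h
    · exact F.a_zero.symm ▸ I.zero_mem
    · exact hapos p h
  refine ⟨hν, ha, fun p hp => ?_⟩
  have hU : mono 0 0 (F.unit : R) - 1 ∈ coeffIdeal I := by
    rw [one_eq_mono, sub_eq_add_neg, ← mono_neg]
    have : mono 0 0 (F.unit : R) + mono 0 0 (-1) = mono 0 0 ((F.unit : R) - 1) := by
      simp [mono, sub_eq_add_neg]
    rw [this]
    exact mono_mem_coeffIdeal hunit 0 0
  have hU' : cf p (mono 0 0 (F.unit : R)) = 0 := by rw [cf_mono, if_neg (show p ≠ (0, 0) from hp)]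
  have h1' : cf p (1 : DoubleLaurent R) = 0 := by rw [cf_one, if_neg hp]
  have h1 := F.neg_eq.cf_sub_one_add_mem haneg p
  have h2 := F.pos_eq.cf_sub_one_add_mem hapos p
  change y = F.neg * (mono 0 0 (F.unit : R) * F.pos) at hyeq
  -- All three factors are 1 modulo I, so modulo I² their deviations from 1 simply add up.
  have h3 : F.neg * (mono 0 0 (F.unit : R) * F.pos) -
      (F.neg - 1) - (F.pos - 1) - mono 0 0 (F.unit : R) ∈ coeffIdeal (I ^ 2) := by
    have : F.neg * (mono 0 0 (F.unit : R) * F.pos) -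
      (F.neg - 1) - (F.pos - 1) - mono 0 0 (F.unit : R) =
      F.pos * ((F.neg - 1) * (mono 0 0 (F.unit : R) - 1)) + (F.neg - 1) * (F.pos - 1) +
        (mono 0 0 (F.unit : R) - 1) * (F.pos - 1) := by ring
    rw [this]
    have hII : I * I ≤ I ^ 2 := (sq I).ge
    exact add_mem (add_mem (Ideal.mul_mem_left _ _ (mul_mem_coeffIdeal hII hN hU))
      (mul_mem_coeffIdeal hII hN hP)) (mul_mem_coeffIdeal hII hU hP)
  have h4 := add_mem (h3 p) (add_mem h1 h2)
  rw [map_sub, map_sub, map_sub, hU', sub_zero, ← hyeq] at h4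
  have h5 : (if p ∈ negIdx then F.a p else 0) + (if p ∈ posIdx then F.a p else 0) = F.a p := by
    rcases mem_negIdx_or_eq_zero_or_mem_posIdx p with h | h | h
    · rw [if_pos h, if_neg (notMem_posIdx_of_mem_negIdx h), add_zero]
    · exact absurd h hp
    · rw [if_pos h, if_neg (fun h' => notMem_posIdx_of_mem_negIdx h' h), zero_add]
  convert h4 using 1
  linear_combination -h5

end Decomposition

/-! ### Existence of decompositions modulo a nilpotent ideal. -/

section Existence

variable {R : Type*} [CommRing R] {I : Ideal R}

theorem isNilpotent_of_mem {n : ℕ} (hI : I ^ n = ⊥) {x : R} (hx : x ∈ I) : IsNilpotent x :=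
  ⟨n, by
    have := Ideal.pow_mem_pow hx n
    rwa [hI, Ideal.mem_bot] at this⟩

theorem prod_mem_pow_card {a : ℤ × ℤ → R} (T : Finset (ℤ × ℤ)) (h : ∀ p ∈ T, a p ∈ I) :
    ∏ p ∈ T, a p ∈ I ^ T.card := by
  have := Ideal.prod_mem_prod (ι := ℤ × ℤ) (s := T) (I := fun _ => I) h
  rwa [Finset.prod_const] at this

theorem exists_bounds_negIdx (e : DoubleLaurent R) :
    ∃ i₀ j₀ : ℤ, ∀ p ∈ negIdx, cf p e ≠ 0 → i₀ < p.1 ∧ j₀ < p.2 := by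
  obtain ⟨M, hM⟩ := ((finite_inter_region (V := {p | cf p e ≠ 0}) (isPWO_support_lex e) 1
    fun _ => 0).image Prod.snd).bddBelow
  refine ⟨e.order - 1, min M 0 - 1, fun p hp h => ⟨?_, ?_⟩⟩
  · by_contra hlt
    refine h ?_
    rw [cf_apply, HahnSeries.coeff_eq_zero_of_lt_order (x := e) (by omega), HahnSeries.coeff_zero]
  · by_contra hlt
    have hp1 : p.1 < 1 := by
      rcases hp with h | h <;> omega
    have := hM ⟨p, ⟨h, hp1, by omega⟩, rfl⟩
    omega

/-- A series congruent to `1` is a product over the negative indices times a series without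
negative terms, up to any power of a nilpotent ideal. -/
theorem exists_negIdx_factor {N : ℕ} (hI : I ^ N = ⊥) {y : DoubleLaurent R}
    (hy : y - 1 ∈ coeffIdeal I) (n : ℕ) :
    ∃ (a : ℤ × ℤ → R) (x w : DoubleLaurent R), (∀ p ∈ negIdx, a p ∈ I) ∧
      (∃ i₀ j₀ : ℤ, ∀ p ∈ negIdx, a p ≠ 0 → i₀ < p.1 ∧ j₀ < p.2) ∧
      HasInfiniteProduct negIdx a x ∧ w - 1 ∈ coeffIdeal I ∧ (∀ q ∈ negIdx, cf q w = 0) ∧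
      y - x * w ∈ coeffIdeal (I ^ (n + 1)) := by
  classical
  induction n with
  | zero =>
    refine ⟨0, 1, 1, by simp, ⟨0, 0, by simp⟩, hasInfiniteProduct_one (by simp), by simp,
      fun q hq => ?_, by simpa using hy⟩
    rw [cf_one, if_neg]
    rintro rfl
    exact zero_notMem_negIdx hq
  | succ n ih =>
    obtain ⟨a, x, w, ha, ⟨i₀, j₀, hb⟩, hax, hw, hwneg, he⟩ := ih
    set e := y - x * w with hedef
    obtain ⟨i₁, j₁, he1⟩ := exists_bounds_negIdx e
    -- The error e splits into its negative part e₁, absorbed by the product x, and the rest,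
    -- absorbed by w.
    obtain ⟨e₁, he₁⟩ := exists_of_bounded (fun q => if q ∈ negIdx then cf q e else 0) i₁ j₁ (by
      intro q hq
      split_ifs at hq with hqn
      · exact ⟨(he1 q hqn hq).1.le, (he1 q hqn hq).2.le⟩
      · exact absurd rfl hq)
    have he₁mem : e₁ ∈ coeffIdeal (I ^ (n + 1)) := fun q => by
      rw [he₁]
      split_ifs
      · exact he q
      · exact Ideal.zero_mem _
    have he₂mem : e - e₁ ∈ coeffIdeal (I ^ (n + 1)) := sub_mem he he₁mem
    have hle : I ^ (n + 1) ≤ I := Ideal.pow_le_self (by omega)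
    -- The factors are 1 - (a + b), so adding e₁ to the product to first order requires the opposite
    -- sign.
    set b : ℤ × ℤ → R := fun p => -cf p e₁ with hbdef
    have hbmem : ∀ p ∈ negIdx, b p ∈ I ^ (n + 1) := fun p _ => neg_mem (he₁mem p)
    have habmem : ∀ p ∈ negIdx, a p + b p ∈ I := fun p hp =>
      add_mem (ha p hp) (hle (hbmem p hp))
    have habbd : ∀ p ∈ negIdx, a p + b p ≠ 0 → min i₀ i₁ < p.1 ∧ min j₀ j₁ < p.2 := by
      intro p hp h
      by_cases hap : a p = 0
      · have hbp : cf p e ≠ 0 := by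
          intro h0
          refine h ?_
          rw [hap, zero_add, hbdef]
          simp [he₁, h0]
        have := he1 p hp hbp
        omega
      · have := hb p hp hap
        omega
    obtain ⟨x', hx'⟩ := exists_hasInfiniteProduct_negIdx (a := fun p => a p + b p) habbd (N := N)
      (by
        intro T hT h0
        by_contra hlt
        refine h0 ?_
        have h1 := prod_mem_pow_card T fun p hp => habmem p (hT hp)
        have h2 := Ideal.pow_le_pow_right (not_le.1 hlt).le h1
        rwa [hI, Ideal.mem_bot] at h2)
    have hδ : x' - x - e₁ ∈ coeffIdeal (I ^ (n + 2)) := fun q => by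
      have := HasInfiniteProduct.cf_sub_add_mem (n := n + 1) (by omega) ha hbmem hax hx' q
      rw [map_sub, map_sub]
      convert this using 1
      split_ifs with hq
      · simp only [hbdef, sub_eq_add_neg]
      · rw [he₁, if_neg hq, sub_zero, add_zero]
    refine ⟨fun p => a p + b p, x', w + (e - e₁), habmem, ⟨_, _, habbd⟩, hx', ?_, ?_, ?_⟩
    · rw [add_sub_right_comm]
      exact add_mem hw (coeffIdeal_mono hle he₂mem)
    · intro q hq
      rw [map_add, hwneg q hq, map_sub, he₁, if_pos hq, sub_self, zero_add]
    · have hx1 := hax.sub_one_mem ha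
      have : y - x' * (w + (e - e₁)) = -((x' - x - e₁) * (w + (e - e₁))) - (x - 1) * (e - e₁) -
          e₁ * (w - 1) - e₁ * (e - e₁) := by
        rw [hedef]
        ring
      rw [this]
      have h1 : I * I ^ (n + 1) ≤ I ^ (n + 1 + 1) := (pow_succ' I (n + 1)).ge
      have h2 : I ^ (n + 1) * I ≤ I ^ (n + 1 + 1) := (pow_succ I (n + 1)).ge
      exact sub_mem (sub_mem (sub_mem (neg_mem (Ideal.mul_mem_right _ _ hδ))
        (mul_mem_coeffIdeal h1 hx1 he₂mem)) (mul_mem_coeffIdeal h2 he₁mem hw))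
        (mul_mem_coeffIdeal h2 he₁mem (coeffIdeal_mono hle he₂mem))

/-- After N corrections the error lies in a zero power of I, so y = x w exactly. The constant term
of w is 1 plus a nilpotent; dividing by it leaves a positive product. -/
theorem Decomposition.nonempty_of_sub_one_mem {N : ℕ} (hI : I ^ N = ⊥) {y : DoubleLaurent R}
    (hy : y - 1 ∈ coeffIdeal I) : Nonempty (Decomposition y) := by
  classical
  obtain ⟨a, x, w, ha, hbd, hax, hw, hwneg, he⟩ := exists_negIdx_factor hI hy N
  have hyxw : y = x * w := by
    rw [← sub_eq_zero]
    refine ext_cf fun q => ?_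
    have := Ideal.pow_le_pow_right N.le_succ (he q)
    rwa [hI, Ideal.mem_bot] at this
  have hunit : IsUnit (cf 0 w) := by
    have h0 := hw 0
    rw [map_sub, cf_one, if_pos rfl] at h0
    have := (isNilpotent_of_mem hI h0).isUnit_one_add
    rwa [add_sub_cancel] at this
  obtain ⟨c, hc⟩ := hunit
  have hcf : ∀ q, cf q (mono 0 0 (c⁻¹ : Rˣ).val * w) = (c⁻¹ : Rˣ).val * cf q w := fun q => by
    rw [cf_mono_mul, show q - (0, 0) = q from sub_zero q]
  obtain ⟨a', ha'⟩ := exists_hasInfiniteProduct_posIdx (mono 0 0 (c⁻¹ : Rˣ).val * w)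
    (by rw [hcf, ← hc, Units.inv_mul]) fun q hq => by rw [hcf, hwneg q hq, mul_zero]
  have hneg : ∀ p ∈ negIdx, (if p ∈ posIdx then a' p else if p ∈ negIdx then a p else 0) = a p :=
    fun p hp => by rw [if_neg (notMem_posIdx_of_mem_negIdx hp), if_pos hp]
  exact ⟨{
    ν₁ := 0
    ν₂ := 0
    unit := c
    a := fun p => if p ∈ posIdx then a' p else if p ∈ negIdx then a p else 0
    neg := x
    pos := mono 0 0 (c⁻¹ : Rˣ).val * w
    a_zero := by
      rw [if_neg (show ((0, 0) : ℤ × ℤ) ∉ posIdx from zero_notMem_posIdx),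
        if_neg (show ((0, 0) : ℤ × ℤ) ∉ negIdx from zero_notMem_negIdx)]
    a_nilpotent := fun p hp => by
      rw [hneg p hp]
      exact isNilpotent_of_mem hI (ha p hp)
    a_bounded := by
      obtain ⟨i₀, j₀, h⟩ := hbd
      exact ⟨i₀, j₀, fun p hp h0 => h p hp (by rwa [hneg p hp] at h0)⟩
    neg_eq := hax.congr fun p hp => (hneg p hp).symm
    pos_eq := ha'.congr fun p hp => (if_pos hp).symm
    eq_mul := by
      rw [mul_assoc, ← mul_assoc (mono 0 0 (c : R)), mono_mul_mono, Units.mul_inv, add_zero,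
        ← one_eq_mono, one_mul, hyxw] }⟩

end Existence

/-! ### Finiteness of the S and Q products. -/

section Finiteness

variable {R : Type*} [CommRing R] {I : Ideal R}

/-- Inserting a new index p into a sufficiently large finite product changes the coefficient at p by
-a p, as the constant term is 1. Stability of that coefficient forces a p = 0. -/
theorem HasInfiniteProduct.finite_support_inter_region {a : ℤ × ℤ → R} {x : DoubleLaurent R}
    (h : HasInfiniteProduct posIdx a x) (m : ℤ) (n : ℤ → ℤ) :
    {p | p ∈ posIdx ∧ a p ≠ 0 ∧ p.1 < m ∧ p.2 < n p.1}.Finite := by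
  classical
  obtain ⟨S, hS, h⟩ := h m n
  refine S.finite_toSet.subset ?_
  rintro p ⟨hp, hap, hpm, hpn⟩
  by_contra hpS
  have hpS : p ∉ S := hpS
  refine hap ?_
  have h1 := h S subset_rfl hS p.1 hpm p.2 hpn
  have h2 := h (insert p S) (Finset.subset_insert p S) (by
    rw [Finset.coe_insert]
    exact Set.insert_subset hp hS) p.1 hpm p.2 hpn
  rw [← cf_apply, map_sub, sub_eq_zero] at h1 h2
  rw [Finset.prod_insert hpS, sub_mul, one_mul, map_sub, h1, cf_mono_mul,
    show p - (p.1, p.2) = 0 from sub_self p, cf_zero_prod hS] at h2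
  simpa using h2

/-- Rows are bounded below, and so is the support in each row: negative indices by `a_bounded`,
positive ones by convergence. -/
theorem Decomposition.isPWO_support {f : DoubleLaurent R} (F : Decomposition f) :
    {q : ℤ ×ₗ ℤ | ofLex q ∈ {p | F.a p ≠ 0}}.IsPWO := by
  obtain ⟨i₀, j₀, hb⟩ := F.a_bounded
  refine Set.PartiallyWellOrderedOn.subsetProdLex ?_ fun i => ?_
  · refine Set.IsWF.isPWO (BddBelow.isWF ⟨min i₀ 0, ?_⟩)
    rintro _ ⟨q, hq, rfl⟩
    rcases mem_negIdx_or_eq_zero_or_mem_posIdx (ofLex q) with h | h | h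
    · exact (min_le_left _ _).trans (hb _ h hq).1.le
    · exact absurd (h ▸ F.a_zero) hq
    · rcases h with h | h
      · exact (min_le_right _ _).trans h.le
      · exact (min_le_right _ _).trans h.1.ge
  · obtain ⟨M, hM⟩ := ((F.pos_eq.finite_support_inter_region (i + 1) fun _ => 0).image
      Prod.snd).bddBelow
    refine Set.IsWF.isPWO (BddBelow.isWF ⟨min j₀ (min M 0), fun j hj => ?_⟩)
    rcases mem_negIdx_or_eq_zero_or_mem_posIdx (i, j) with h | h | h
    · exact (min_le_left _ _).trans (hb _ h hj).2.le
    · exact absurd (show F.a (i, j) = 0 from h ▸ F.a_zero) hj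
    · refine (min_le_right _ _).trans ?_
      by_cases hj0 : j < 0
      · exact (min_le_left _ _).trans (hM ⟨(i, j), ⟨h, hj, by simp, hj0⟩, rfl⟩)
      · exact (min_le_right _ _).trans (not_lt.1 hj0)

theorem isPWO_image_nsmul {V : Set (ℤ × ℤ)} (hV : {q : ℤ ×ₗ ℤ | ofLex q ∈ V}.IsPWO) (α : ℕ) :
    {q : ℤ ×ₗ ℤ | ofLex q ∈ (fun p => α • p) '' V}.IsPWO := by
  refine (hV.image_of_monotone (f := fun q : ℤ ×ₗ ℤ => α • q)
    fun p q hpq => nsmul_le_nsmul_right hpq α).mono ?_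
  rintro q ⟨p, hp, hpq⟩
  exact ⟨toLex p, hp, by simpa using congrArg toLex hpq⟩

theorem finite_pairs {V W : Set (ℤ × ℤ)} (hV : {q : ℤ ×ₗ ℤ | ofLex q ∈ V}.IsPWO)
    (hW : {q : ℤ ×ₗ ℤ | ofLex q ∈ W}.IsPWO) {α β : ℕ} (hα : 0 < α) (hβ : 0 < β) :
    {x : (ℤ × ℤ) × (ℤ × ℤ) | x.1 ∈ V ∧ x.2 ∈ W ∧ α • x.1 + β • x.2 = 0}.Finite := by
  refine Set.Finite.of_finite_image (f := fun x => α • x.1)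
    ((finite_addAntidiagonal_lex (isPWO_image_nsmul hV α) (isPWO_image_nsmul hW β) 0).subset ?_) ?_
  · rintro _ ⟨x, ⟨h1, h2, h⟩, rfl⟩
    exact ⟨⟨x.1, h1, rfl⟩, x.2, h2, by rw [← h]; simp⟩
  · rintro x ⟨-, -, hx⟩ y ⟨-, -, hy⟩ hxy
    have hxy : α • x.1 = α • y.1 := hxy
    have hxy' : β • x.2 = β • y.2 := by
      rw [hxy] at hx
      exact add_left_cancel (hx.trans hy.symm)
    exact Prod.ext (nsmul_right_injective hα.ne' hxy) (nsmul_right_injective hβ.ne' hxy')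

/-- Nilpotency bounds the exponents α and β by N, and for each pair of exponents only finitely many
pairs of indices in well-ordered supports satisfy the relation. -/
theorem finite_of_factor_ne_one {N : ℕ} (hI : I ^ N = ⊥) {f g : DoubleLaurent R}
    (F : Decomposition f) (G : Decomposition g) (hF : ∀ p, F.a p ∈ I) (hG : ∀ p, G.a p ∈ I)
    {φ : (ℤ × ℤ) × (ℤ × ℤ) → Rˣ}
    (hφ : ∀ x, φ x ≠ 1 → ∃ α β : ℕ, 0 < α ∧ 0 < β ∧ α • x.1 + β • x.2 = 0 ∧
      F.a x.1 ^ α * G.a x.2 ^ β ≠ 0) : (mulSupport φ).Finite := by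
  refine (Set.Finite.biUnion (Finset.finite_toSet (Finset.Icc 1 N ×ˢ Finset.Icc 1 N)) (t := fun z =>
    {x : (ℤ × ℤ) × (ℤ × ℤ) | F.a x.1 ≠ 0 ∧ G.a x.2 ≠ 0 ∧ z.1 • x.1 + z.2 • x.2 = 0}) ?_).subset ?_
  · rintro ⟨α, β⟩ hz
    simp only [Finset.coe_product, Set.mem_prod, Finset.mem_coe, Finset.mem_Icc] at hz
    exact finite_pairs F.isPWO_support G.isPWO_support hz.1.1 hz.2.1
  · intro x hx
    obtain ⟨α, β, hα, hβ, h, h0⟩ := hφ x hx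
    have hpow : ∀ {c : R} {γ : ℕ}, c ∈ I → c ^ γ ≠ 0 → γ ≤ N := fun {c γ} hc h0 => by
      by_contra hlt
      refine h0 ?_
      have := Ideal.pow_le_pow_right (not_le.1 hlt).le (Ideal.pow_mem_pow hc γ)
      rwa [hI, Ideal.mem_bot] at this
    refine Set.mem_biUnion (x := (α, β)) ?_ ⟨fun h' => h0 ?_, fun h' => h0 ?_, h⟩
    · simp only [Finset.coe_product, Set.mem_prod, Finset.mem_coe, Finset.mem_Icc]
      exact ⟨⟨hα, hpow (hF _) (left_ne_zero_of_mul h0)⟩, hβ,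
        hpow (hG _) (right_ne_zero_of_mul h0)⟩
    · rw [h', zero_pow hα.ne', zero_mul]
    · rw [h', zero_pow hβ.ne', mul_zero]

theorem finite_mulSupport_famS {N : ℕ} (hI : I ^ N = ⊥) {f g : DoubleLaurent R}
    (F : Decomposition f) (G : Decomposition g) (hF : ∀ p, F.a p ∈ I) (hG : ∀ p, G.a p ∈ I) :
    (mulSupport (famS F.a G.a)).Finite :=
  finite_of_factor_ne_one hI F G hF hG fun _ hx => exists_of_factorS_ne_one hx

theorem finite_mulSupport_famQ {N : ℕ} (hI : I ^ N = ⊥) {f g : DoubleLaurent R}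
    (F : Decomposition f) (G : Decomposition g) (hF : ∀ p, F.a p ∈ I) (hG : ∀ p, G.a p ∈ I) :
    (mulSupport (famQ F.a G.a)).Finite :=
  finite_of_factor_ne_one hI F G hF hG fun _ hx => exists_of_factorQ_ne_one hx

end Finiteness

/-! ### The residue as a finite sum. -/

section ResidueFormula

variable {k : Type*} [Field k]

theorem cf_derivT (q : ℤ × ℤ) (x : DoubleLaurent k) :
    cf q (derivT x) = (q.1 + 1 : ℤ) * cf (q + (1, 0)) x := by
  rw [cf_apply, derivT, LaurentSeries.derivative_apply, LaurentSeries.hasseDeriv_coeff,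
    Ring.choose_one_right, ← zsmul_eq_mul, cf_apply, Prod.snd_add, add_zero]
  exact map_zsmul (HahnSeries.coeff.addMonoidHom q.2) (q.1 + 1) (x.coeff (q.1 + 1))

theorem cf_derivU (q : ℤ × ℤ) (x : DoubleLaurent k) :
    cf q (derivU x) = (q.2 + 1 : ℤ) * cf (q + (0, 1)) x := by
  rw [cf_apply, derivU, HahnSeries.map_coeff, cf_apply]
  change ((LaurentSeries.derivative k (x.coeff q.1)).coeff q.2) = _
  rw [LaurentSeries.derivative_apply, LaurentSeries.hasseDeriv_coeff]
  simp

theorem finite_support_weighted_conv (w : ℤ × ℤ → k) (g h : DoubleLaurent k) (s : ℤ × ℤ) :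
    (support fun q => w q * (cf q g * cf (s - q) h)).Finite :=
  (finite_support_conv g h s).subset fun _ hq =>
    ⟨left_ne_zero_of_mul (right_ne_zero_of_mul hq), right_ne_zero_of_mul (right_ne_zero_of_mul hq)⟩

/-- Differentiation multiplies each coefficient by its exponent and shifts the index; after
reindexing, the two products of exponents combine to a determinant. The shift (1, 1) makes the
residue correspond to triples of indices with sum 0. -/
theorem cf_derivU_mul_derivT_sub (g h : DoubleLaurent k) (s : ℤ × ℤ) :
    cf (s - (1, 1)) (derivU g * derivT h - derivU h * derivT g) =
      ∑ᶠ q, (det q (s - q) : k) * (cf q g * cf (s - q) h) := by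
  have h1 : cf (s - (1, 1)) (derivU g * derivT h) =
      ∑ᶠ q : ℤ × ℤ, ((q.2 * (s - q).1 : ℤ) : k) * (cf q g * cf (s - q) h) := by
    rw [cf_mul, ← finsum_comp_equiv (Equiv.subRight ((0, 1) : ℤ × ℤ))]
    refine finsum_congr fun q => ?_
    rw [Equiv.subRight_apply, cf_derivU, cf_derivT, sub_add_cancel,
      show s - (1, 1) - (q - (0, 1)) + (1, 0) = s - q from
        Prod.ext (by simp; ring) (by simp),
      show (q - ((0, 1) : ℤ × ℤ)).2 + 1 = q.2 by simp,
      show (s - (1, 1) - (q - (0, 1)) : ℤ × ℤ).1 + 1 = (s - q).1 by simp; ring]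
    push_cast
    ring
  have h2 : cf (s - (1, 1)) (derivU h * derivT g) =
      ∑ᶠ q : ℤ × ℤ, (((s - q).2 * q.1 : ℤ) : k) * (cf q g * cf (s - q) h) := by
    rw [mul_comm, cf_mul, ← finsum_comp_equiv (Equiv.subRight ((1, 0) : ℤ × ℤ))]
    refine finsum_congr fun q => ?_
    rw [Equiv.subRight_apply, cf_derivU, cf_derivT, sub_add_cancel,
      show s - (1, 1) - (q - (1, 0)) + (0, 1) = s - q from
        Prod.ext (by simp) (by simp; ring),
      show (q - ((1, 0) : ℤ × ℤ)).1 + 1 = q.1 by simp,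
      show (s - (1, 1) - (q - (1, 0)) : ℤ × ℤ).2 + 1 = (s - q).2 by simp; ring]
    push_cast
    ring
  rw [map_sub, h1, h2, ← finsum_sub_distrib (finite_support_weighted_conv _ g h s)
    (finite_support_weighted_conv _ g h s)]
  refine finsum_congr fun q => ?_
  rw [← sub_mul, ← Int.cast_sub]
  rfl

theorem finite_support_triple (f g h : DoubleLaurent k) :
    {z : (ℤ × ℤ) × (ℤ × ℤ) | cf z.1 f * (cf z.2 g * cf (-z.1 - z.2) h) ≠ 0}.Finite := by
  have hsum : {z : ℤ ×ₗ ℤ | ofLex z ∈ {z | ∃ q, cf q g ≠ 0 ∧ cf (z - q) h ≠ 0}}.IsPWO := by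
    refine ((isPWO_support_lex g).add (isPWO_support_lex h)).mono ?_
    rintro z ⟨q, hq, hz⟩
    exact ⟨toLex q, hq, toLex (ofLex z - q), hz, add_sub_cancel (toLex q) z⟩
  refine (Set.Finite.biUnion (finite_addAntidiagonal_lex (s := {p | cf p f ≠ 0})
    (isPWO_support_lex f) hsum 0) fun p _ => (Set.finite_singleton p).prod
      (finite_support_conv g h (-p))).subset ?_
  rintro ⟨p, q⟩ hz
  have hp := left_ne_zero_of_mul hz
  have hq := left_ne_zero_of_mul (right_ne_zero_of_mul hz)
  have hr := right_ne_zero_of_mul (right_ne_zero_of_mul hz)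
  exact Set.mem_biUnion (x := p) ⟨hp, q, hq, by rwa [zero_sub]⟩ ⟨rfl, hq, hr⟩

/-- The residue as a sum over triples of indices with sum zero. -/
theorem resWedge_eq_finsum (f g h : DoubleLaurent k) :
    resWedge f g h = ∑ᶠ z : (ℤ × ℤ) × (ℤ × ℤ),
      (det z.2 (-z.1 - z.2) : k) * (cf z.1 f * (cf z.2 g * cf (-z.1 - z.2) h)) := by
  have hfin : (support fun z : (ℤ × ℤ) × (ℤ × ℤ) =>
      (det z.2 (-z.1 - z.2) : k) * (cf z.1 f * (cf z.2 g * cf (-z.1 - z.2) h))).Finite :=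
    (finite_support_triple f g h).subset fun z hz => right_ne_zero_of_mul hz
  rw [finsum_curry _ hfin]
  change cf (-1, -1) _ = _
  rw [cf_mul]
  refine finsum_congr fun p => ?_
  rw [show ((-1, -1) : ℤ × ℤ) - p = -p - (1, 1) by ext <;> simp <;> ring,
    cf_derivU_mul_derivT_sub, mul_finsum]
  exact finsum_congr fun q => by ring

end ResidueFormula

/-! ### The ideal (ε) of k[ε]/ε⁴. -/

section TruncatedRing

variable {k : Type*} [Field k]

/-- The reduction `k[ε]/ε⁴ → k`. -/
noncomputable def truncRes (k : Type*) [Field k] : Trunc k →+* k :=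
  AdjoinRoot.lift (RingHom.id k) 0 (by simp)

theorem mem_span_eps_iff {x : Trunc k} : x ∈ Ideal.span {eps k} ↔ truncRes k x = 0 := by
  rw [Ideal.mem_span_singleton]
  constructor
  · rintro ⟨y, rfl⟩
    rw [map_mul, eps, truncRes, AdjoinRoot.lift_root, zero_mul]
  · induction x using AdjoinRoot.induction_on with
    | ih p =>
      rw [truncRes, AdjoinRoot.lift_mk, Polynomial.eval₂_id, ← Polynomial.coeff_zero_eq_eval_zero,
        ← Polynomial.X_dvd_iff]
      rintro ⟨q, rfl⟩
      exact ⟨AdjoinRoot.mk _ q, by rw [map_mul, AdjoinRoot.mk_X]; rfl⟩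

theorem span_eps_pow_four : Ideal.span {eps k} ^ 4 = ⊥ := by
  rw [Ideal.span_singleton_pow, eps_pow_four, Ideal.span_singleton_eq_bot]

theorem span_eps_ne_top : Ideal.span {eps k} ≠ ⊤ := fun h => by
  have : (1 : Trunc k) ∈ Ideal.span {eps k} := h ▸ Submodule.mem_top
  rw [mem_span_eps_iff, map_one] at this
  exact one_ne_zero this

theorem mem_span_eps_of_isNilpotent (x : Trunc k) (hx : IsNilpotent x) :
    x ∈ Ideal.span {eps k} :=
  mem_span_eps_iff.2 (hx.map (truncRes k)).eq_zero

theorem cf_oneAddEps_sub_one (f : DoubleLaurent k) (q : ℤ × ℤ) :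
    cf q ((oneAddEps f : DoubleLaurent (Trunc k)) - 1) =
      eps k * algebraMap k (Trunc k) (cf q f) := by
  have : (oneAddEps f : DoubleLaurent (Trunc k)) - 1 = mono 0 0 (eps k) * extend f :=
    add_sub_cancel_left _ _
  rw [this, cf_mono_mul, show q - (0, 0) = q from sub_zero q]
  rfl

theorem oneAddEps_sub_one_mem (f : DoubleLaurent k) :
    (oneAddEps f : DoubleLaurent (Trunc k)) - 1 ∈ coeffIdeal (Ideal.span {eps k}) := fun q => by
  rw [cf_oneAddEps_sub_one]
  exact Ideal.mul_mem_right _ _ (Ideal.mem_span_singleton_self _)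

end TruncatedRing

/-! ### The factor T for indices with sum zero. -/

section FactorValue

variable {R : Type*} [CommRing R]

theorem isUnit_one_sub_of_mul_self {y : R} (hy : y * y = 0) : IsUnit (1 - y) :=
  IsNilpotent.isUnit_one_sub ⟨2, by rw [sq, hy]⟩

theorem coe_toUnit_one_sub_pow {y : R} (hy : y * y = 0) (n : ℕ) :
    ((toUnit (1 - y) ^ n : Rˣ) : R) = 1 - n * y := by
  induction n with
  | zero => simp
  | succ n ih =>
    rw [pow_succ, Units.val_mul, ih, coe_toUnit (isUnit_one_sub_of_mul_self hy)]
    push_cast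
    linear_combination (n : R) * hy

theorem coe_toUnit_one_sub_zpow {y : R} (hy : y * y = 0) (n : ℤ) :
    ((toUnit (1 - y) ^ n : Rˣ) : R) = 1 - n * y := by
  obtain ⟨m, rfl | rfl⟩ := n.eq_nat_or_neg
  · rw [zpow_natCast, coe_toUnit_one_sub_pow hy, Int.cast_natCast]
  · rw [zpow_neg, zpow_natCast]
    refine Units.inv_eq_of_mul_eq_one_right ?_
    rw [coe_toUnit_one_sub_pow hy]
    push_cast
    linear_combination -(m : R) ^ 2 * hy

/-- When the indices sum to 0 the three determinants coincide, so d is their absolute value and all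
inner exponents are 1. Since (abc)² = 0, the outer power is linear in its exponent, for either sign.
-/
theorem coe_factorT_of_add_eq_zero {p q : ℤ × ℤ} {a b c : R}
    (h : (a * b * c) * (a * b * c) = 0) :
    (factorT p q (-p - q) a b c : R) = 1 - det q (-p - q) * (a * b * c) := by
  have h1 : det (-p - q) p = det q (-p - q) := by simp [det]; ring
  have h2 : det p q = det q (-p - q) := by simp [det]; ring
  unfold factorT
  rw [h1, h2]
  generalize det q (-p - q) = n
  simp only [and_self, Nat.gcd_self]
  rcases lt_trichotomy n 0 with hn | rfl | hn
  · rw [if_neg hn.not_gt, if_pos hn, Nat.div_self (Int.natAbs_pos.2 hn.ne), pow_one, pow_one,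
      pow_one, Int.natCast_natAbs, abs_of_neg hn, neg_neg, coe_toUnit_one_sub_zpow h]
  · simp
  · rw [if_pos hn, Nat.div_self (Int.natAbs_pos.2 hn.ne'), pow_one, pow_one,
      pow_one, Int.natCast_natAbs, abs_of_pos hn, coe_toUnit_one_sub_zpow h]

end FactorValue

/-! ### The symbol over k[ε]/ε⁴. -/

section TruncatedSymbol

variable {k : Type*} [Field k] {f g h : DoubleLaurent k}

theorem mul_mul_mem_pow_three {R : Type*} [CommRing R] {I : Ideal R} {a b c : R} (ha : a ∈ I)
    (hb : b ∈ I) (hc : c ∈ I) : a * b * c ∈ I ^ 3 := by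
  rw [pow_succ, sq]
  exact Ideal.mul_mem_mul (Ideal.mul_mem_mul ha hb) hc

/-- Replace a, b, c by -x, -y, -z one at a time; each replacement costs a product in I² · I · I = I⁴
= 0. -/
theorem mul_mul_eq_of_add_mem {a b c x y z : Trunc k} (hx : x ∈ Ideal.span {eps k})
    (hy : y ∈ Ideal.span {eps k}) (hb : b ∈ Ideal.span {eps k})
    (hc : c ∈ Ideal.span {eps k}) (hxa : x + a ∈ Ideal.span {eps k} ^ 2)
    (hyb : y + b ∈ Ideal.span {eps k} ^ 2) (hzc : z + c ∈ Ideal.span {eps k} ^ 2) :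
    a * b * c = -(x * y * z) := by
  have h4 : ∀ {u v w : Trunc k}, u ∈ Ideal.span {eps k} ^ 2 → v ∈ Ideal.span {eps k} →
      w ∈ Ideal.span {eps k} → u * v * w = 0 := fun {u v w} hu hv hw => by
    have := Ideal.mul_mem_mul (Ideal.mul_mem_mul hu hv) hw
    rw [← pow_succ, ← pow_succ, span_eps_pow_four] at this
    exact this
  linear_combination h4 hxa hb hc - h4 hyb hx hc + h4 hzc hx hy

namespace Decomposition

variable (F : Decomposition (oneAddEps f : DoubleLaurent (Trunc k)))
  (G : Decomposition (oneAddEps g : DoubleLaurent (Trunc k)))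
  (H : Decomposition (oneAddEps h : DoubleLaurent (Trunc k)))

theorem ν_eq_zero : F.ν = 0 :=
  (F.of_sub_one_mem span_eps_ne_top mem_span_eps_of_isNilpotent (oneAddEps_sub_one_mem f)).1

theorem a_mem (p : ℤ × ℤ) : F.a p ∈ Ideal.span {eps k} :=
  (F.of_sub_one_mem span_eps_ne_top mem_span_eps_of_isNilpotent (oneAddEps_sub_one_mem f)).2.1 p

theorem add_a_mem {p : ℤ × ℤ} (hp : p ≠ 0) :
    eps k * algebraMap k (Trunc k) (cf p f) + F.a p ∈ Ideal.span {eps k} ^ 2 := by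
  have := (F.of_sub_one_mem span_eps_ne_top mem_span_eps_of_isNilpotent
    (oneAddEps_sub_one_mem f)).2.2 p hp
  rwa [← cf_oneAddEps_sub_one, map_sub, cf_one, if_neg hp, sub_zero]

theorem a_mul_a_mul_a {p q r : ℤ × ℤ} (hp : p ≠ 0) (hq : q ≠ 0) (hr : r ≠ 0) :
    F.a p * G.a q * H.a r =
      -(eps k ^ 3 * algebraMap k (Trunc k) (cf p f * (cf q g * cf r h))) := by
  have hmem : ∀ x : Trunc k, eps k * x ∈ Ideal.span {eps k} := fun x =>
    Ideal.mul_mem_right _ _ (Ideal.mem_span_singleton_self _)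
  rw [mul_mul_eq_of_add_mem (hmem _) (hmem _) (G.a_mem q) (H.a_mem r) (F.add_a_mem hp)
    (G.add_a_mem hq) (H.add_a_mem hr)]
  simp only [map_mul]
  ring

/-- The value of a factor `T` whose indices have sum zero. -/
theorem coe_famT (p q : ℤ × ℤ) :
    (famT F.a G.a H.a (p, q, -p - q) : Trunc k) = 1 + eps k ^ 3 * algebraMap k (Trunc k)
      (det q (-p - q) * (cf p f * (cf q g * cf (-p - q) h))) := by
  have hsq : (F.a p * G.a q * H.a (-p - q)) * (F.a p * G.a q * H.a (-p - q)) = 0 := by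
    have h3 := mul_mul_mem_pow_three (F.a_mem p) (G.a_mem q) (H.a_mem (-p - q))
    have := Ideal.mul_mem_mul h3 h3
    rw [← pow_add] at this
    have := Ideal.pow_le_pow_right (show 4 ≤ 3 + 3 by norm_num) this
    rwa [span_eps_pow_four, Ideal.mem_bot] at this
  refine (coe_factorT_of_add_eq_zero hsq).trans ?_
  -- The congruence a_p ≡ -ε f_p is available only for p ≠ 0; if one of the three indices is 0 the
  -- determinant vanishes and both sides are 1.
  by_cases hdet : det q (-p - q) = 0
  · simp [hdet]
  have hp : p ≠ 0 := by
    rintro rfl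
    exact hdet (by simp [det, mul_comm])
  have hq : q ≠ 0 := by
    rintro rfl
    exact hdet (by simp [det])
  have hr : -p - q ≠ 0 := fun h0 => hdet (by rw [h0]; simp [det])
  rw [F.a_mul_a_mul_a G H hp hq hr, map_mul _ (det q (-p - q) : k), map_intCast]
  ring

/-- Three positive weights whose monomial is nonzero must have sum less than 4, because I⁴ = 0. So
each weight is 1. -/
theorem of_famT_ne_one {x : (ℤ × ℤ) × (ℤ × ℤ) × (ℤ × ℤ)} (hx : famT F.a G.a H.a x ≠ 1) :
    x.2.2 = -x.1 - x.2.1 ∧ cf x.1 f * (cf x.2.1 g * cf x.2.2 h) ≠ 0 := by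
  obtain ⟨α, β, γ, hα, hβ, hγ, hsum, h0⟩ := exists_of_factorT_ne_one hx
  have hle : α + β + γ < 4 := by
    by_contra hlt
    refine h0 ?_
    have h1 := Ideal.mul_mem_mul (Ideal.mul_mem_mul (Ideal.pow_mem_pow (F.a_mem x.1) α)
      (Ideal.pow_mem_pow (G.a_mem x.2.1) β)) (Ideal.pow_mem_pow (H.a_mem x.2.2) γ)
    rw [← pow_add, ← pow_add] at h1
    have h2 := Ideal.pow_le_pow_right (not_lt.1 hlt) h1
    rwa [span_eps_pow_four, Ideal.mem_bot] at h2
  obtain rfl : α = 1 := by omega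
  obtain rfl : β = 1 := by omega
  obtain rfl : γ = 1 := by omega
  simp only [one_smul, pow_one] at hsum h0
  refine ⟨by rw [eq_neg_of_add_eq_zero_right hsum]; abel, fun hz => h0 ?_⟩
  rw [F.a_mul_a_mul_a G H, hz, map_zero, mul_zero, neg_zero]
  · exact fun h' => h0 (by rw [h', show F.a 0 = 0 from F.a_zero, zero_mul, zero_mul])
  · exact fun h' => h0 (by rw [h', show G.a 0 = 0 from G.a_zero, mul_zero, zero_mul])
  · exact fun h' => h0 (by rw [h', show H.a 0 = 0 from H.a_zero, mul_zero])

theorem mulSupport_famT_subset : mulSupport (famT F.a G.a H.a) ⊆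
    (fun z : (ℤ × ℤ) × (ℤ × ℤ) => (z.1, z.2, -z.1 - z.2)) ''
      {z | cf z.1 f * (cf z.2 g * cf (-z.1 - z.2) h) ≠ 0} := by
  rintro ⟨p, q, r⟩ hx
  obtain ⟨hr, h0⟩ := F.of_famT_ne_one G H hx
  dsimp only at hr h0
  subst hr
  exact ⟨(p, q), h0, rfl⟩

theorem finiteFactors_of_oneAddEps : F.FiniteFactors G H :=
  ⟨((finite_support_triple f g h).image _).subset (F.mulSupport_famT_subset G H),
    finite_mulSupport_famS span_eps_pow_four F G F.a_mem G.a_mem,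
    finite_mulSupport_famQ span_eps_pow_four F G F.a_mem G.a_mem,
    finite_mulSupport_famS span_eps_pow_four H F H.a_mem F.a_mem,
    finite_mulSupport_famQ span_eps_pow_four H F H.a_mem F.a_mem,
    finite_mulSupport_famS span_eps_pow_four G H G.a_mem H.a_mem,
    finite_mulSupport_famQ span_eps_pow_four G H G.a_mem H.a_mem⟩

/-- The cross terms contain ε⁶ = 0. -/
theorem prod_one_add_eps {ι : Type*} (Z : Finset ι) (c : ι → k) :
    ∏ z ∈ Z, (1 + eps k ^ 3 * algebraMap k (Trunc k) (c z)) =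
      1 + eps k ^ 3 * algebraMap k (Trunc k) (∑ z ∈ Z, c z) := by
  induction Z using Finset.cons_induction with
  | empty => simp
  | cons z Z hz ih =>
    rw [Finset.prod_cons, Finset.sum_cons, ih, map_add]
    linear_combination (eps k ^ 2 * algebraMap k (Trunc k) (c z) *
      algebraMap k (Trunc k) (∑ z ∈ Z, c z)) * eps_pow_four k

theorem coe_finprod_famT : ((∏ᶠ x, famT F.a G.a H.a x : (Trunc k)ˣ) : Trunc k) =
    1 + eps k ^ 3 * algebraMap k (Trunc k) (resWedge f g h) := by
  classical
  have hfin := finite_support_triple f g h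
  have hinj : Injective fun z : (ℤ × ℤ) × (ℤ × ℤ) => (z.1, z.2, -z.1 - z.2) := fun z w hzw => by
    simp only [Prod.mk.injEq] at hzw
    exact Prod.ext hzw.1 hzw.2.1
  rw [finprod_eq_prod_of_mulSupport_subset (s := hfin.toFinset.image
    fun z : (ℤ × ℤ) × (ℤ × ℤ) => (z.1, z.2, -z.1 - z.2)), Finset.prod_image hinj.injOn,
    Units.coe_prod, Finset.prod_congr rfl fun z _ => F.coe_famT G H z.1 z.2, prod_one_add_eps,
    resWedge_eq_finsum, finsum_eq_sum_of_support_subset (s := hfin.toFinset)]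
  · rw [Set.Finite.coe_toFinset]
    exact fun z hz => right_ne_zero_of_mul hz
  · rw [Finset.coe_image, Set.Finite.coe_toFinset]
    exact F.mulSupport_famT_subset G H

theorem coe_symbol_of_oneAddEps : (F.symbol G H : Trunc k) =
    1 + eps k ^ 3 * algebraMap k (Trunc k) (resWedge f g h) := by
  have hF := F.ν_eq_zero
  have hG := G.ν_eq_zero
  have hH := H.ν_eq_zero
  rw [← F.coe_finprod_famT G H, symbol, hF, hG, hH, show F.ν₁ = 0 from congrArg Prod.fst hF,
    show F.ν₂ = 0 from congrArg Prod.snd hF, show G.ν₁ = 0 from congrArg Prod.fst hG,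
    show G.ν₂ = 0 from congrArg Prod.snd hG, show H.ν₁ = 0 from congrArg Prod.fst hH,
    show H.ν₂ = 0 from congrArg Prod.snd hH]
  simp [signExp, det]

end Decomposition

theorem isSymbolValue_oneAddEps_iff {c : (Trunc k)ˣ} :
    IsSymbolValue (oneAddEps f) (oneAddEps g) (oneAddEps h) c ↔
      (c : Trunc k) = 1 + eps k ^ 3 * algebraMap k (Trunc k) (resWedge f g h) := by
  constructor
  · rintro ⟨F, G, H, -, rfl⟩
    exact F.coe_symbol_of_oneAddEps G H
  · intro hc
    have hne : ∀ f : DoubleLaurent k,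
        Nonempty (Decomposition (oneAddEps f : DoubleLaurent (Trunc k))) := fun f =>
      Decomposition.nonempty_of_sub_one_mem span_eps_pow_four (oneAddEps_sub_one_mem f)
    obtain ⟨F⟩ := hne f
    obtain ⟨G⟩ := hne g
    obtain ⟨H⟩ := hne h
    exact ⟨F, G, H, F.finiteFactors_of_oneAddEps G H,
      Units.ext (hc.trans (F.coe_symbol_of_oneAddEps G H).symm)⟩

theorem isUnit_one_add_eps (c : k) : IsUnit (1 + eps k ^ 3 * algebraMap k (Trunc k) c) :=
  IsNilpotent.isUnit_one_add ⟨2, by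
    linear_combination (eps k ^ 2 * algebraMap k (Trunc k) c ^ 2) * eps_pow_four k⟩

end TruncatedSymbol

end ContouCarrere

theorem mainTheorem8 (k : Type*) [Field k] :
    (∀ f g h : (ContouCarrere.DoubleLaurent k)ˣ,
      (∃! c : kˣ, ContouCarrere.IsSymbolValue f g h c) ∧
      ((ContouCarrere.symbol f g h : kˣ) : k) = ContouCarrere.tameSymbol f g h) ∧
    (∀ f g h : ContouCarrere.DoubleLaurent k,
      (∃! c : (ContouCarrere.Trunc k)ˣ, ContouCarrere.IsSymbolValue
        (ContouCarrere.oneAddEps f) (ContouCarrere.oneAddEps g) (ContouCarrere.oneAddEps h) c) ∧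
      ((ContouCarrere.symbol (ContouCarrere.oneAddEps f) (ContouCarrere.oneAddEps g)
        (ContouCarrere.oneAddEps h) : (ContouCarrere.Trunc k)ˣ) : ContouCarrere.Trunc k) =
        1 + ContouCarrere.eps k ^ 3 *
          algebraMap k (ContouCarrere.Trunc k) (ContouCarrere.resWedge f g h)) := by
  refine ⟨fun f g h => ContouCarrere.existsUnique_and_symbol_eq ?_
    fun c => ContouCarrere.isSymbolValue_field_iff, fun f g h =>
    ContouCarrere.existsUnique_and_symbol_eq (ContouCarrere.isUnit_one_add_eps _)
      fun c => ContouCarrere.isSymbolValue_oneAddEps_iff⟩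
  rw [ContouCarrere.tameSymbol_eq]
  exact Units.isUnit _
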